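/- Setting. Let $B$ (buyers) and $I$ (items) be finite sets and let $G\subseteq B\times I$ be a bipartite graph in which every buyer and every item is incident to at most $d$ edges. An allocation is feasible iff it is a matching in $G$ (so each buyer gets at most one item and each item goes to at most one buyer). Buyer $i$ has a value $v_{ij}\ge 0$ for item $j$, $(i,j)\in G$; the values are independent, $v_e\sim\mathcal D_e$ for $e\in G$, and $\mathcal D=\prod_{e\in G}\mathcal D_e$. A (possibly randomized) mechanism maps every bid profile $b$ to a probability distribution over matchings, with marginals $x_{e}(b)$, and to expected payments $p_i(b)$, $i\in B$. The utility of buyer $i$ with values $v_i$ is $\sum_{j:(i,j)\in G} x_{ij}(b)v_{ij}-p_i(b)$. The mechanism is truthful if, for all nonnegative bids of the other buyers, reporting $v_i$ maximizes the utility of $i$ (dominant strategy truthfulness), and it is individually rational if a truthful buyer never has negative utility. Its revenue is $\mathbb E_{v\sim\mathcal D}[\sum_i p_i(v)]$. An auction using $N$ samples is a map, not depending on $\mathcal D$, that assigns a mechanism to every $(s^1,\dots,s^N)\in(\mathbb R^{G})^N$; its revenue is the expectation over independent $s^1,\dots,s^N,v\sim\mathcal D$. All maps are measurable. Each $\mathcal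 D_e$ is supported on $[0,\infty)$ and has a density $f$, with distribution function $F$; it is MHR if (for some version of the density) $f/(1-F)$ is nondecreasing on $\{F<1\}$, and regular if $f>0$ and $x-\frac{1-F(x)}{f(x)}$ is nondecreasing on $\{0<F<1\}$. Theorem. Let $d\ge 0$ and let $G$ be as above with maximum degree at most $d$. (1) There is an auction using $d^2+1$ samples that is truthful and individually rational for all values of the samples and such that, whenever every $\mathcal D_e$, $e\in G$, is MHR (not necessarily identical), its revenue is at least $\frac{1}{13.5\,e}$ times the revenue of every truthful, individually rational (possibly randomized) mechanism for $G$ and $\mathcal D$. (2) There is an auction using $d^2+1$ samples that is truthful and individually rational for all values of the samples and such that, whenever all $\mathcal D_e$, $e\in G$, are equal to one regular distribution, its revenue is at least $\frac1{27}$ times the revenue of every truthful, individually rational deterministic mechanism for $G$ and $\mathcal D$. The mechanisms to which the auctions are compared may depend on $\mathcal D$. -/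

import Mathlib

open MeasureTheory

noncomputable section

namespace UnitDemandMatching

/-! ### Degree-bounded bipartite matching environments

`B` is the set of buyers, `I` the set of items and `G ⊆ B × I` the set of edges: an edge `(i, j)`
says that buyer `i` may receive item `j`. -/

/-- Every buyer and every item is incident to at most `d` edges. -/
def DegreeAtMost {B I : Type*} [DecidableEq B] [DecidableEq I]
    (G : Finset (B × I)) (d : ℕ) : Prop :=
  (∀ i : B, (G.filter (fun e => e.1 = i)).card ≤ d) ∧
  (∀ j : I, (G.filter (fun e => e.2 = j)).card ≤ d)

/-- A feasible allocation: no two edges of `S` share a buyer or an item. In particular no buyer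
receives more than one item (unit demand). -/
def IsMatching {B I : Type*} {G : Finset (B × I)} (S : Finset G) : Prop :=
  ∀ e ∈ S, ∀ e' ∈ S, e ≠ e' → e.1.1 ≠ e'.1.1 ∧ e.1.2 ≠ e'.1.2

/-- A profile of values (or of bids, or a sample): one number for every edge. -/
abbrev Profile {B I : Type*} (G : Finset (B × I)) : Type _ := G → ℝ

/-! ### Mechanisms -/

/-- A (possibly randomized) direct mechanism. On the bid profile `b` it implements the feasible
allocation `S` with probability `lottery b S` and charges buyer `i` the expected payment
`pay b i`. -/
structure Mechanism {B I : Type*} (G : Finset (B × I)) where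
  lottery : Profile G → Finset G → ℝ
  pay : Profile G → B → ℝ
  lottery_nonneg : ∀ b S, 0 ≤ lottery b S
  lottery_sum : ∀ b, ∑ S, lottery b S = 1
  lottery_feasible : ∀ b S, lottery b S ≠ 0 → IsMatching S
  measurable_lottery : ∀ S, Measurable (fun b => lottery b S)
  measurable_pay : ∀ i, Measurable (fun b => pay b i)

namespace Mechanism

variable {B I : Type*} [DecidableEq B] [DecidableEq I] {G : Finset (B × I)}

/-- The probability that buyer `e.1` receives item `e.2`, on the bid profile `b`. -/
def allocProb (M : Mechanism G) (b : Profile G) (e : G) : ℝ :=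
  ∑ S ∈ Finset.univ.filter (fun S : Finset G => e ∈ S), M.lottery b S

/-- The expected utility of buyer `i` with true values `v` (only the coordinates of `v` that
belong to `i` matter) when the reported profile is `b`. -/
def utility (M : Mechanism G) (i : B) (v b : Profile G) : ℝ :=
  ∑ e ∈ Finset.univ.filter (fun e : G => e.1.1 = i), M.allocProb b e * v e - M.pay b i

/-- Dominant strategy truthfulness: whatever the others bid, no buyer `i` gains by reporting
something else than the true values. The profile `v` consists of the true values of `i` and the
bids of the others; the profile `b` differs from it only in the report of `i`. -/
def Truthful (M : Mechanism G) : Prop :=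
  ∀ (i : B) (v b : Profile G), (∀ e, 0 ≤ v e) → (∀ e, 0 ≤ b e) →
    (∀ e : G, e.1.1 ≠ i → b e = v e) → M.utility i v b ≤ M.utility i v v

/-- A buyer who reports truthfully never has negative utility. -/
def IndividuallyRational (M : Mechanism G) : Prop :=
  ∀ (i : B) (v : Profile G), (∀ e, 0 ≤ v e) → 0 ≤ M.utility i v v

/-- On every bid profile one feasible allocation is chosen with certainty. -/
def Deterministic (M : Mechanism G) : Prop :=
  ∀ b, ∃ S, M.lottery b S = 1

end Mechanism

/-- An auction that learns about the value distribution only through `N` sample profiles: for all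
values of the samples it is a mechanism. -/
structure SampleAuction {B I : Type*} (G : Finset (B × I)) (N : ℕ) where
  mech : (Fin N → Profile G) → Mechanism G
  measurable_lottery : ∀ S, Measurable
    (fun p : (Fin N → Profile G) × Profile G => (mech p.1).lottery p.2 S)
  measurable_pay : ∀ i, Measurable
    (fun p : (Fin N → Profile G) × Profile G => (mech p.1).pay p.2 i)

/-! ### Expected revenue -/

/-- The expectation of `f` as an extended real number, `E[f⁺] - E[f⁻]`. (Where both terms are
infinite it is `⊥`.) -/
def expectation {Ω : Type*} [MeasurableSpace Ω] (P : Measure Ω) (f : Ω → ℝ) : EReal :=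
  ((∫⁻ ω, ENNReal.ofReal (f ω) ∂P : ENNReal) : EReal) -
    ((∫⁻ ω, ENNReal.ofReal (-(f ω)) ∂P : ENNReal) : EReal)

/-- The expected revenue of a mechanism when the values `v e` are independent with laws `D e`. -/
def Mechanism.revenue {B I : Type*} [Fintype B] {G : Finset (B × I)}
    (M : Mechanism G) (D : G → Measure ℝ) : EReal :=
  expectation (Measure.pi D) (fun v => ∑ i, M.pay v i)

/-- The expected revenue of a sample-based auction, over independent samples and values that
are all drawn from the product of the laws `D e`. -/
def SampleAuction.revenue {B I : Type*} [Fintype B] {G : Finset (B × I)} {N : ℕ}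
    (A : SampleAuction G N) (D : G → Measure ℝ) : EReal :=
  expectation ((Measure.pi (fun _ : Fin N => Measure.pi D)).prod (Measure.pi D))
    (fun p => ∑ i, (A.mech p.1).pay p.2 i)

/-! ### Value distributions -/

/-- `μ` lives on the nonnegative reals and has the probability density function `f`. -/
structure HasValueDensity (μ : Measure ℝ) (f : ℝ → ℝ) : Prop where
  measurable : Measurable f
  nonneg : ∀ x, 0 ≤ f x
  eq_withDensity : μ = volume.withDensity (fun x => ENNReal.ofReal (f x))
  support : μ (Set.Iio 0) = 0

/-- The hazard rate `f / (1 - F)`. -/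
def hazardRate (μ : Measure ℝ) (f : ℝ → ℝ) (x : ℝ) : ℝ :=
  f x / (1 - ProbabilityTheory.cdf μ x)

/-- The virtual value `x - (1 - F x) / f x`. -/
def virtualValue (μ : Measure ℝ) (f : ℝ → ℝ) (x : ℝ) : ℝ :=
  x - (1 - ProbabilityTheory.cdf μ x) / f x

/-- Monotone hazard rate: the hazard rate is nondecreasing where it is defined (`F < 1`). -/
def IsMHR (μ : Measure ℝ) : Prop :=
  ∃ f, HasValueDensity μ f ∧
    MonotoneOn (hazardRate μ f) {x | ProbabilityTheory.cdf μ x < 1}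

/-- Regularity: the virtual value is nondecreasing on the support. Since the virtual value is
`-∞` where `f = 0` and `F < 1`, the density has to be positive where `0 < F < 1`. -/
def IsRegular (μ : Measure ℝ) : Prop :=
  ∃ f, HasValueDensity μ f ∧
    (∀ x, 0 < ProbabilityTheory.cdf μ x → ProbabilityTheory.cdf μ x < 1 → 0 < f x) ∧
    MonotoneOn (virtualValue μ f)
      {x | 0 < ProbabilityTheory.cdf μ x ∧ ProbabilityTheory.cdf μ x < 1}

end UnitDemandMatching

end

/-! Both auctions post prices built from a threshold rule: `T e v` ignores `v e`, and the edges with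
`T e v < v e` form a matching (`IsThreshold`). The price of `e` is the larger of `T e`, evaluated on
a sample, and the value of `e` in one further sample, which acts as a reserve. Each edge is put on
sale with probability 1/3, and the buyers arrive in a fixed order or its reverse with probability
1/2 each.

Lower bound (`lintegral_pay_ge`). Let q_e be the probability that v_e exceeds its threshold.
Computing the threshold from an independent sample leaves q_e unchanged, and the q_e at one buyer or
at one item sum to at most 1. Only on-sale edges of the same buyer, or of the same item and an
earlier buyer, can block `e`, so the union bound makes `e` on sale and unblocked with probability at
least 1/3 - 1/9 - 1/18 = 1/6. Conflicting edges read their thresholds from different samples, by a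
proper colouring of the conflict graph, so blocking is independent of the acceptance of the price of
`e`. The revenue is therefore at least 1/6 of the sum over `e` of the expected `sampleRevenue` at
T_e. For a regular law, that is at least half of p(1 - F(p)) for every p ≥ T_e
(`IsRegular.revenue_le_sampleRevenue`): the revenue curve is concave in the quantile, so one sample
is a good price.

Upper bound, MHR case. Revenue is at most welfare, hence at most the weight of a maximum matching,
all of whose edges reach the thresholds of `matchingThreshold`. The welfare of values above T is at
most e times the best revenue of a price p ≥ T (`IsMHR.lintegral_le`), because some such price p has
a survival function dominated by an exponential tail of mean p.

Upper bound, regular case. Edge by edge, a deterministic truthful mechanism posts a price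
independent of the value of the edge, so it earns at most virtual surplus plus `revenueAtInfinity`.
With identical laws, the order of the values is also the order of the positive parts of the virtual
values. The greedy matching by values is then a 2-approximation for virtual surplus, although it
never uses the law. Above each greedy threshold, virtual surplus and revenue at infinity are again
bounded by a single-price revenue (`revenueAtInfinity_add_le`).

The losses multiply to 6·2·e and 6·2·2, slightly better than the stated 13.5·e and 27. -/

noncomputable section

namespace UnitDemandMatching

set_option linter.unusedSectionVars false

open ProbabilityTheory Set Filter Topology

/-! ### Survival functions of distributions with a density -/

/-- The survival function `1 - F`. -/
def survival (μ : Measure ℝ) (x : ℝ) : ℝ := 1 - cdf μ x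

lemma survival_nonneg (μ : Measure ℝ) (x : ℝ) : 0 ≤ survival μ x :=
  sub_nonneg.2 (cdf_le_one μ x)

lemma survival_antitone (μ : Measure ℝ) : Antitone (survival μ) := fun _ _ h =>
  sub_le_sub_left (monotone_cdf μ h) 1

lemma measurable_survival (μ : Measure ℝ) : Measurable (survival μ) :=
  (survival_antitone μ).measurable

lemma ofReal_survival (μ : Measure ℝ) [IsProbabilityMeasure μ] [NullSingletonClass μ] (x : ℝ) :
    ENNReal.ofReal (survival μ x) = μ (Ici x) := by
  rw [survival, cdf_eq_real, ← probReal_compl_eq_one_sub measurableSet_Iic, compl_Iic,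
    ofReal_measureReal, measure_congr Ioi_ae_eq_Ici]

namespace HasValueDensity

variable {μ : Measure ℝ} {f : ℝ → ℝ}

lemma nullSingletonClass (h : HasValueDensity μ f) : NullSingletonClass μ := by
  rw [h.eq_withDensity]; infer_instance

variable [IsProbabilityMeasure μ]

lemma integrable (h : HasValueDensity μ f) : Integrable f := by
  refine ⟨h.measurable.aestronglyMeasurable, ?_⟩
  rw [hasFiniteIntegral_iff_ofReal (ae_of_all _ h.nonneg), ← setLIntegral_univ,
    ← withDensity_apply _ MeasurableSet.univ, ← h.eq_withDensity]
  simp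

lemma measure_eq (h : HasValueDensity μ f) {s : Set ℝ} (hs : MeasurableSet s) :
    μ s = ENNReal.ofReal (∫ x in s, f x) := by
  rw [ofReal_integral_eq_lintegral_ofReal h.integrable.integrableOn (ae_of_all _ h.nonneg),
    ← withDensity_apply _ hs, ← h.eq_withDensity]

lemma survival_sub (h : HasValueDensity μ f) {x y : ℝ} (hxy : x ≤ y) :
    survival μ x - survival μ y = ∫ t in x..y, f t := by
  have h1 : cdf μ y = cdf μ x + μ.real (Ioc x y) := by
    rw [cdf_eq_real, cdf_eq_real, ← measureReal_union (Iic_disjoint_Ioc le_rfl)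
      measurableSet_Ioc, Iic_union_Ioc_eq_Iic hxy]
  rw [intervalIntegral.integral_of_le hxy, survival, survival, h1, Measure.real,
    h.measure_eq measurableSet_Ioc, ENNReal.toReal_ofReal
      (integral_nonneg h.nonneg)]
  ring

lemma survival_eq (h : HasValueDensity μ f) (x y : ℝ) :
    survival μ y = survival μ x + -∫ t in x..y, f t := by
  rcases le_total x y with hxy | hxy
  · linarith [h.survival_sub hxy]
  · rw [intervalIntegral.integral_symm]; linarith [h.survival_sub hxy]

/-- The density is merely measurable, so `survival` is differentiable only almost everywhere;
absolute continuity is what licenses integration by parts. -/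
lemma absolutelyContinuous_survival (h : HasValueDensity μ f) (x y : ℝ) :
    AbsolutelyContinuousOnInterval (survival μ) x y := by
  rw [show survival μ = (fun _ => survival μ x) + -fun y => ∫ t in x..y, f t from
    funext fun y => h.survival_eq x y]
  refine AbsolutelyContinuousOnInterval.add ?_ (AbsolutelyContinuousOnInterval.neg ?_)
  · exact (contDiff_const (n := 1)).contDiffOn.absolutelyContinuousOnInterval
  · exact h.integrable.intervalIntegrable.absolutelyContinuousOnInterval_intervalIntegral
      left_mem_uIcc

lemma continuous_survival (h : HasValueDensity μ f) : Continuous (survival μ) := by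
  rw [show survival μ = fun y => survival μ 0 + -∫ t in (0:ℝ)..y, f t from
    funext fun y => h.survival_eq 0 y]
  exact continuous_const.add (intervalIntegral.continuous_primitive
    (fun _ _ => h.integrable.intervalIntegrable) 0).neg

lemma ae_deriv_survival (h : HasValueDensity μ f) (x y : ℝ) :
    ∀ᵐ t, t ∈ uIcc x y → deriv (survival μ) t = -f t := by
  have hi : IntervalIntegrable f volume x y := h.integrable.intervalIntegrable
  filter_upwards [hi.ae_hasDerivAt_integral] with t ht htm
  rw [show survival μ = fun y => survival μ x + -∫ t in x..y, f t from
    funext fun y => h.survival_eq x y]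
  exact ((ht htm x left_mem_uIcc).neg.const_add _).deriv

/-- Integration by parts for `u * (1 - F)`. -/
lemma integral_by_parts (h : HasValueDensity μ f) {u u' : ℝ → ℝ}
    (hu : ∀ x, HasDerivAt u (u' x) x) (hu' : Continuous u') (x y : ℝ) :
    ∫ t in x..y, (u' t * survival μ t - u t * f t) =
      u y * survival μ y - u x * survival μ x := by
  have hd : deriv u = u' := funext fun x => (hu x).deriv
  have hc : ContDiff ℝ 1 u := contDiff_one_iff_deriv.2
    ⟨fun x => (hu x).differentiableAt, by rwa [hd]⟩
  rw [← AbsolutelyContinuousOnInterval.integral_deriv_mul_eq_sub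
    hc.contDiffOn.absolutelyContinuousOnInterval (h.absolutelyContinuous_survival x y)]
  refine intervalIntegral.integral_congr_ae ?_
  filter_upwards [h.ae_deriv_survival x y] with t ht htm
  rw [ht (uIoc_subset_uIcc htm), hd]
  ring

lemma intervalIntegrable_parts (h : HasValueDensity μ f) {u u' : ℝ → ℝ}
    (hu : Continuous u) (hu' : Continuous u') (x y : ℝ) :
    IntervalIntegrable (fun t => u' t * survival μ t - u t * f t) volume x y := by
  refine IntervalIntegrable.sub ?_ ?_
  · exact (hu'.mul h.continuous_survival).intervalIntegrable _ _
  · exact h.integrable.intervalIntegrable.continuousOn_mul hu.continuousOn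

/-- Monotonicity test for u(1 - F), whose a.e. derivative is u'(1 - F) - uf. It is applied with u(t)
= t - c for regular laws and u(t) = exp(t/p) for MHR laws. -/
lemma mul_survival_le_of_ae (h : HasValueDensity μ f) {u u' : ℝ → ℝ}
    (hu : ∀ x, HasDerivAt u (u' x) x) (hu' : Continuous u') {x y : ℝ} (hxy : x ≤ y)
    (hle : ∀ᵐ t, t ∈ Ioo x y → u' t * survival μ t ≤ u t * f t) :
    u y * survival μ y ≤ u x * survival μ x := by
  rw [← sub_nonpos, ← h.integral_by_parts hu hu', intervalIntegral.integral_of_le hxy,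
    integral_Ioc_eq_integral_Ioo]
  refine integral_nonpos_of_ae ((ae_restrict_iff' measurableSet_Ioo).2 ?_)
  filter_upwards [hle] with t ht htm
  simpa using ht htm

lemma le_mul_survival_of_ae (h : HasValueDensity μ f) {u u' : ℝ → ℝ}
    (hu : ∀ x, HasDerivAt u (u' x) x) (hu' : Continuous u') {x y : ℝ} (hxy : x ≤ y)
    (hle : ∀ᵐ t, t ∈ Ioo x y → u t * f t ≤ u' t * survival μ t) :
    u x * survival μ x ≤ u y * survival μ y := by
  rw [← sub_nonneg, ← h.integral_by_parts hu hu', intervalIntegral.integral_of_le hxy,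
    integral_Ioc_eq_integral_Ioo]
  refine integral_nonneg_of_ae ((ae_restrict_iff' measurableSet_Ioo).2 ?_)
  filter_upwards [hle] with t ht htm
  simpa using ht htm

lemma measure_Iic_zero (h : HasValueDensity μ f) : μ (Iic 0) = 0 := by
  have := h.nullSingletonClass
  rw [← measure_congr Iio_ae_eq_Iic, h.support]

lemma cdf_zero (h : HasValueDensity μ f) : cdf μ 0 = 0 := by
  rw [cdf_eq_real, Measure.real, h.measure_Iic_zero, ENNReal.toReal_zero]

lemma survival_zero (h : HasValueDensity μ f) : survival μ 0 = 1 := by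
  rw [survival, h.cdf_zero, sub_zero]

lemma ae_pos (h : HasValueDensity μ f) : ∀ᵐ x ∂μ, 0 < x := by
  rw [ae_iff, show {a : ℝ | ¬ 0 < a} = Iic 0 by ext; simp, h.measure_Iic_zero]

lemma continuous_cdf (h : HasValueDensity μ f) : Continuous (cdf μ) := by
  have : (fun x => cdf μ x) = fun x => 1 - survival μ x := by
    funext x; simp [survival]
  rw [show (cdf μ : ℝ → ℝ) = fun x => 1 - survival μ x from this]
  exact continuous_const.sub h.continuous_survival

/-- By continuity, F still vanishes at the supremum of its zero set, so that set lies in a null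
half-line. -/
lemma ae_cdf_pos (h : HasValueDensity μ f) : ∀ᵐ x ∂μ, 0 < cdf μ x := by
  have hs : {x | ¬ 0 < cdf μ x} = cdf μ ⁻¹' Iic 0 := by ext; simp
  rw [ae_iff, hs]
  have hc : IsClosed (cdf μ ⁻¹' Iic 0) := isClosed_Iic.preimage h.continuous_cdf
  obtain ⟨b, hb⟩ := ((tendsto_cdf_atTop μ).eventually (lt_mem_nhds one_half_lt_one)).exists
  have hbdd : BddAbove (cdf μ ⁻¹' Iic 0) := ⟨b, fun x hx => by
    by_contra! hbx
    have := monotone_cdf μ hbx.le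
    have hx' : cdf μ x ≤ 0 := hx
    linarith⟩
  have hne : (cdf μ ⁻¹' Iic 0).Nonempty := ⟨0, by simp [h.cdf_zero]⟩
  have hm : cdf μ (sSup (cdf μ ⁻¹' Iic 0)) ≤ 0 := hc.csSup_mem hne hbdd
  refine measure_mono_null (t := Iic (sSup (cdf μ ⁻¹' Iic 0)))
    (fun x hx => le_csSup hbdd hx) ?_
  rw [← ofReal_cdf, ENNReal.ofReal_eq_zero]
  exact hm

lemma ae_density_eq_zero_of_measure (h : HasValueDensity μ f) {A : Set ℝ}
    (hA : MeasurableSet A) (h0 : μ A = 0) : ∀ᵐ t : ℝ, t ∈ A → f t = 0 := by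
  rw [h.eq_withDensity, withDensity_apply _ hA, lintegral_eq_zero_iff
    h.measurable.ennreal_ofReal, Filter.EventuallyEq, ae_restrict_iff' hA] at h0
  filter_upwards [h0] with t ht htA
  exact le_antisymm (by simpa using ht htA) (h.nonneg t)

lemma ae_density_eq_zero_of_cdf (h : HasValueDensity μ f) :
    ∀ᵐ t : ℝ, cdf μ t = 0 → f t = 0 := by
  filter_upwards [h.ae_density_eq_zero_of_measure
    (measurableSet_lt measurable_const (monotone_cdf μ).measurable).compl h.ae_cdf_pos]
    with t ht htc
  exact ht (by simp [htc])

end HasValueDensity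

section Distributions

variable {μ : Measure ℝ} [IsProbabilityMeasure μ] {f : ℝ → ℝ}

/-! ### Regular distributions -/

lemma virtualValue_le (h : HasValueDensity μ f) (x : ℝ) : virtualValue μ f x ≤ x :=
  sub_le_self _ (div_nonneg (survival_nonneg μ x) (h.nonneg x))

lemma survival_eq_of_density_pos {x : ℝ} (hx : 0 < f x) :
    survival μ x = (x - virtualValue μ f x) * f x := by
  rw [virtualValue, sub_sub_cancel, div_mul_cancel₀ _ hx.ne', survival]

/-- A zero of the nonnegative nondecreasing hazard rate forces zeros at all earlier points; then no
mass lies below x, against F(x) > 0. -/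
theorem IsMHR.density_pos (h : HasValueDensity μ f)
    (hm : MonotoneOn (hazardRate μ f) {x | cdf μ x < 1}) {x : ℝ} (h0 : 0 < cdf μ x)
    (h1 : cdf μ x < 1) : 0 < f x := by
  by_contra hx
  have hfx : f x = 0 := le_antisymm (not_lt.1 hx) (h.nonneg x)
  have hz : ∀ t ∈ Ioo 0 x, f t = 0 := by
    intro t ht
    have ht1 : cdf μ t < 1 := (monotone_cdf μ ht.2.le).trans_lt h1
    have := hm ht1 h1 ht.2.le
    rw [hazardRate, hazardRate, hfx, zero_div, div_le_iff₀ (sub_pos.2 ht1), zero_mul] at this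
    exact le_antisymm this (h.nonneg t)
  have hx0 : 0 ≤ x := by
    by_contra! hneg
    have := monotone_cdf μ hneg.le
    rw [h.cdf_zero] at this
    linarith
  have := h.survival_sub hx0
  rw [intervalIntegral.integral_of_le hx0, integral_Ioc_eq_integral_Ioo,
    setIntegral_congr_fun measurableSet_Ioo (g := fun _ => 0) hz, integral_zero, h.survival_zero,
    survival] at this
  linarith

theorem IsMHR.isRegular (hμ : IsMHR μ) : IsRegular μ := by
  obtain ⟨f, h, hm⟩ := hμ
  refine ⟨f, h, fun x h0 h1 => IsMHR.density_pos h hm h0 h1, ?_⟩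
  intro x hx y hy hxy
  have hfx := IsMHR.density_pos h hm hx.1 hx.2
  have hfy := IsMHR.density_pos h hm hy.1 hy.2
  have hsx : 0 < 1 - cdf μ x := sub_pos.2 hx.2
  have hsy : 0 < 1 - cdf μ y := sub_pos.2 hy.2
  have := hm hx.2 hy.2 hxy
  rw [hazardRate, hazardRate, div_le_div_iff₀ hsx hsy] at this
  have h2 : (1 - cdf μ y) / f y ≤ (1 - cdf μ x) / f x := by
    rw [div_le_div_iff₀ hfy hfx]; linarith
  rw [virtualValue, virtualValue]
  linarith

/-- The tangent bounds on the survival function of a regular distribution: the function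
`t ↦ (t - c) * (1 - F t)` with `c` the virtual value at `r` is maximal at `r`. -/
lemma sub_virtualValue_mul_survival_le (h : HasValueDensity μ f)
    (hpos : ∀ x, 0 < cdf μ x → cdf μ x < 1 → 0 < f x)
    (hmono : MonotoneOn (virtualValue μ f) {x | 0 < cdf μ x ∧ cdf μ x < 1})
    {r : ℝ} (hr0 : 0 < cdf μ r) (hr1 : cdf μ r < 1) (t : ℝ) :
    (t - virtualValue μ f r) * survival μ t ≤ (r - virtualValue μ f r) * survival μ r := by
  set c := virtualValue μ f r
  have hd : ∀ x : ℝ, HasDerivAt (fun t => t - c) ((fun _ => (1:ℝ)) x) x := fun x =>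
    (hasDerivAt_id x).sub_const c
  rcases le_total r t with hrt | htr
  · refine h.mul_survival_le_of_ae hd continuous_const hrt (ae_of_all _ fun s hs => ?_)
    have hcs : c ≤ s := (virtualValue_le h r).trans hs.1.le
    rcases (cdf_le_one μ s).lt_or_eq with h1 | h1
    · have h0 : 0 < cdf μ s := hr0.trans_le (monotone_cdf μ hs.1.le)
      have := hmono ⟨hr0, hr1⟩ ⟨h0, h1⟩ hs.1.le
      rw [one_mul, survival_eq_of_density_pos (hpos s h0 h1)]
      exact mul_le_mul_of_nonneg_right (by linarith) (h.nonneg s)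
    · rw [survival, h1]
      simpa using mul_nonneg (sub_nonneg.2 hcs) (h.nonneg s)
  -- The derivative of (t - c)(1 - F(t)) is (c - φ(t)) f(t), with φ the virtual value. Below the
  -- support φ carries no information, but there f = 0 almost everywhere and the derivative is 1 - F
  -- ≥ 0.
  · refine h.le_mul_survival_of_ae hd continuous_const htr ?_
    filter_upwards [h.ae_density_eq_zero_of_cdf] with s hs hsm
    have h1 : cdf μ s < 1 := (monotone_cdf μ hsm.2.le).trans_lt hr1
    rcases (cdf_nonneg μ s).lt_or_eq with h0 | h0
    · have := hmono ⟨h0, h1⟩ ⟨hr0, hr1⟩ hsm.2.le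
      rw [one_mul, survival_eq_of_density_pos (hpos s h0 h1)]
      exact mul_le_mul_of_nonneg_right (by linarith) (h.nonneg s)
    · rw [hs h0.symm, mul_zero, one_mul]
      exact survival_nonneg μ s

/-- The revenue `x (1 - F x)` relative to `F x` is nonincreasing for a regular distribution. -/
theorem IsRegular.revenue_mul_cdf_le (hμ : IsRegular μ) {r p : ℝ} (hr : 0 ≤ r) (hrp : r ≤ p) :
    p * survival μ p * cdf μ r ≤ r * survival μ r * cdf μ p := by
  obtain ⟨f, h, hpos, hmono⟩ := hμ
  have hrhs : 0 ≤ r * survival μ r * cdf μ p :=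
    mul_nonneg (mul_nonneg hr (survival_nonneg _ _)) (cdf_nonneg _ _)
  rcases (cdf_nonneg μ r).lt_or_eq with hr0 | hr0
  swap
  -- In quantile space the revenue curve is concave and vanishes at quantile 1 (price 0), so the
  -- chord slopes to that endpoint are monotone. The tangent at r is compared with the points of
  -- price p and price 0.
  · rwa [← hr0, mul_zero]
  rcases (survival_nonneg μ p).lt_or_eq with hp1 | hp1
  swap
  · rwa [← hp1, mul_zero, zero_mul]
  have hr1 : cdf μ r < 1 := (monotone_cdf μ hrp).trans_lt (sub_pos.1 hp1)
  have a1 := sub_virtualValue_mul_survival_le h hpos hmono hr0 hr1 p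
  have a2 := sub_virtualValue_mul_survival_le h hpos hmono hr0 hr1 0
  rw [h.survival_zero] at a2
  have hGr : 0 < survival μ r := sub_pos.2 hr1
  have hcr : cdf μ r = 1 - survival μ r := by simp [survival]
  have hcp : cdf μ p = 1 - survival μ p := by simp [survival]
  have hK : 0 < r - virtualValue μ f r := by
    rw [virtualValue, sub_sub_cancel]
    exact div_pos hGr (hpos r hr0 hr1)
  rw [hcr, hcp]
  generalize virtualValue μ f r = c at *
  generalize survival μ r = g at *
  generalize survival μ p = q at *
  -- The right side is exactly r·g times the slack of `a1` plus (p - r)·q·g times the slack of `a2`.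
  have key : 0 ≤ (r - c) * g * ((r * g - p * q) + (p - r) * (q * g)) := by
    nlinarith [mul_nonneg hr (mul_nonneg hGr.le (sub_nonneg.2 a1)), mul_nonneg (mul_nonneg (sub_nonneg.2 hrp) (mul_nonneg hp1.le hGr.le)) (sub_nonneg.2 a2)]
  have := nonneg_of_mul_nonneg_right key (mul_pos hK hGr)
  nlinarith

/-! ### One sample as a reserve price -/

/-- Of two independent draws one is at least the other, and by symmetry both orders have the same
mass. -/
lemma measure_univ_sq_le_lintegral_Ici (ν : Measure ℝ) [IsFiniteMeasure ν] :
    ν univ * ν univ ≤ 2 * ∫⁻ r, ν (Ici r) ∂ν := by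
  have m1 : MeasurableSet {q : ℝ × ℝ | q.1 ≤ q.2} := measurableSet_le measurable_fst measurable_snd
  have m2 : MeasurableSet {q : ℝ × ℝ | q.2 ≤ q.1} := measurableSet_le measurable_snd measurable_fst
  have e1 : (ν.prod ν) {q : ℝ × ℝ | q.1 ≤ q.2} = ∫⁻ r, ν (Ici r) ∂ν := by
    rw [Measure.prod_apply m1]; rfl
  have e2 : (ν.prod ν) {q : ℝ × ℝ | q.2 ≤ q.1} = ∫⁻ r, ν (Ici r) ∂ν := by
    rw [Measure.prod_apply_symm m2]; rfl
  rw [← Measure.prod_prod, univ_prod_univ, two_mul]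
  nth_rw 1 [← e1, ← e2]
  refine (measure_mono fun q _ => ?_).trans (measure_union_le _ _)
  exact le_total q.1 q.2

lemma measure_univ_sq_le_lintegral_Iic (ν : Measure ℝ) [IsFiniteMeasure ν] :
    ν univ * ν univ ≤ 2 * ∫⁻ r, ν (Iic r) ∂ν := by
  have m1 : MeasurableSet {q : ℝ × ℝ | q.1 ≤ q.2} := measurableSet_le measurable_fst measurable_snd
  have m2 : MeasurableSet {q : ℝ × ℝ | q.2 ≤ q.1} := measurableSet_le measurable_snd measurable_fst
  have e1 : (ν.prod ν) {q : ℝ × ℝ | q.1 ≤ q.2} = ∫⁻ r, ν (Iic r) ∂ν := by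
    rw [Measure.prod_apply_symm m1]; rfl
  have e2 : (ν.prod ν) {q : ℝ × ℝ | q.2 ≤ q.1} = ∫⁻ r, ν (Iic r) ∂ν := by
    rw [Measure.prod_apply m2]; rfl
  rw [← Measure.prod_prod, univ_prod_univ, two_mul]
  nth_rw 1 [← e1, ← e2]
  refine (measure_mono fun q _ => ?_).trans (measure_union_le _ _)
  exact le_total q.1 q.2

/-- The expected revenue from one buyer at the larger one of the price `T` and a sample. -/
def sampleRevenue (μ : Measure ℝ) (T : ℝ) : ENNReal :=
  ∫⁻ r, ENNReal.ofReal (max T r * survival μ (max T r)) ∂μ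

/-- A single sample as a reserve price earns half of the revenue of every price above `T`. -/
theorem IsRegular.revenue_le_sampleRevenue (hμ : IsRegular μ) {T p : ℝ} (hT : 0 ≤ T)
    (hTp : T ≤ p) : ENNReal.ofReal (p * survival μ p) ≤ 2 * sampleRevenue μ T := by
  obtain ⟨f, h, -⟩ := id hμ
  have := h.nullSingletonClass
  have hp : 0 ≤ p := hT.trans hTp
  have hms := measurable_survival μ
  -- With G = 1 - F, split pG(p) = pG(p)² + pG(p)F(p). Samples r ≥ p pay for the first term, since
  -- rG(r) ≥ pG(r) and G(r) averages to G(p)²/2 over them. Samples r < p pay for the second, since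
  -- the revenue at max(T, r) is at least pG(p)F(r)/F(p) and F(r) averages to F(p)²/2.
  rw [sampleRevenue, ← lintegral_add_compl _ (measurableSet_Ici (a := p)), compl_Ici, mul_add]
  have h1 : ENNReal.ofReal p * (μ (Ici p) * μ (Ici p)) ≤
      2 * ∫⁻ r in Ici p, ENNReal.ofReal (max T r * survival μ (max T r)) ∂μ := by
    have h2 := measure_univ_sq_le_lintegral_Ici (μ.restrict (Ici p))
    rw [Measure.restrict_apply_univ] at h2
    refine (mul_le_mul_right h2 _).trans ?_
    rw [mul_left_comm, ← lintegral_const_mul _ (by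
      exact (Antitone.measurable fun a b hab => measure_mono (Ici_subset_Ici.2 hab)))]
    refine mul_le_mul_right (setLIntegral_mono' measurableSet_Ici fun r hr => ?_) _
    have hr' : p ≤ r := hr
    rw [max_eq_right (hTp.trans hr'), ENNReal.ofReal_mul (hp.trans hr'), ofReal_survival]
    exact mul_le_mul' (ENNReal.ofReal_le_ofReal hr') (Measure.restrict_apply_le _ _)
  have h3 : ENNReal.ofReal (p * survival μ p * cdf μ p) ≤
      2 * ∫⁻ r in Iio p, ENNReal.ofReal (max T r * survival μ (max T r)) ∂μ := by
    rcases (cdf_nonneg μ p).lt_or_eq with hFp | hFp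
    swap
    · rw [← hFp]; simp
    have h2 := measure_univ_sq_le_lintegral_Iic (μ.restrict (Iio p))
    rw [Measure.restrict_apply_univ, measure_congr Iio_ae_eq_Iic, ← ofReal_cdf,
      ← ENNReal.ofReal_mul hFp.le] at h2
    have hK : 0 ≤ p * survival μ p / cdf μ p :=
      div_nonneg (mul_nonneg hp (survival_nonneg _ _)) hFp.le
    have h4 : p * survival μ p * cdf μ p =
        p * survival μ p / cdf μ p * (cdf μ p * cdf μ p) := by
      field_simp
    rw [h4, ENNReal.ofReal_mul hK]
    refine (mul_le_mul_right h2 _).trans ?_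
    rw [mul_left_comm, ← lintegral_const_mul _ (by
      exact (Monotone.measurable fun a b hab => measure_mono (Iic_subset_Iic.2 hab)))]
    refine mul_le_mul_right (setLIntegral_mono' measurableSet_Iio fun r hr => ?_) _
    have hr' : r < p := hr
    refine (mul_le_mul_right (Measure.restrict_apply_le _ _) _).trans ?_
    rw [← ofReal_cdf, ← ENNReal.ofReal_mul hK]
    refine ENNReal.ofReal_le_ofReal ?_
    rw [div_mul_eq_mul_div, div_le_iff₀ hFp]
    refine le_trans ?_ (hμ.revenue_mul_cdf_le (hT.trans (le_max_left T r)) (max_le hTp hr'.le))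
    exact mul_le_mul_of_nonneg_left (monotone_cdf μ (le_max_right T r))
      (mul_nonneg hp (survival_nonneg _ _))
  refine le_trans (le_of_eq ?_) (add_le_add h1 h3)
  rw [← ofReal_survival, ← ENNReal.ofReal_mul (survival_nonneg _ _), ← ENNReal.ofReal_mul hp,
    ← ENNReal.ofReal_add (mul_nonneg hp (mul_self_nonneg _))
      (mul_nonneg (mul_nonneg hp (survival_nonneg _ _)) (cdf_nonneg _ _))]
  congr 1
  rw [survival]
  ring

/-! ### Revenue and virtual values -/

/-- The limit inferior of the revenue of a price that tends to infinity. It is positive for some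
regular distributions with infinite mean, whose virtual values do not account for it. -/
def revenueAtInfinity (μ : Measure ℝ) : ENNReal :=
  liminf (fun y => ENNReal.ofReal (y * survival μ y)) atTop

lemma HasValueDensity.setLIntegral_eq (h : HasValueDensity μ f) {g : ℝ → ENNReal}
    (hg : Measurable g) {s : Set ℝ} (hs : MeasurableSet s) :
    ∫⁻ x in s, g x ∂μ = ∫⁻ x in s, g x * ENNReal.ofReal (f x) := by
  nth_rw 1 [h.eq_withDensity]
  rw [setLIntegral_withDensity_eq_setLIntegral_mul _ h.measurable.ennreal_ofReal hg hs]
  simp only [Pi.mul_apply, mul_comm]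

lemma HasValueDensity.measurable_virtualValue (h : HasValueDensity μ f) :
    Measurable (virtualValue μ f) :=
  measurable_id.sub ((measurable_const.sub (monotone_cdf μ).measurable).div h.measurable)

lemma ofReal_integral_le_lintegral {α : Type*} [MeasurableSpace α] {ν : Measure α} {g : α → ℝ}
    (hg : Integrable g ν) : ENNReal.ofReal (∫ x, g x ∂ν) ≤ ∫⁻ x, ENNReal.ofReal (g x) ∂ν := by
  have h1 : ∫ x, g x ∂ν ≤ ∫ x, max (g x) 0 ∂ν :=
    integral_mono hg hg.pos_part fun x => le_max_left _ _
  refine (ENNReal.ofReal_le_ofReal h1).trans ?_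
  rw [ofReal_integral_eq_lintegral_ofReal hg.pos_part (ae_of_all _ fun x => le_max_right _ _)]
  refine lintegral_mono fun x => ?_
  rw [ENNReal.ofReal_max]
  simp

lemma HasValueDensity.revenue_sub (h : HasValueDensity μ f) {x y : ℝ} (hxy : x ≤ y) :
    x * survival μ x - y * survival μ y = ∫ t in Ioc x y, (t * f t - survival μ t) := by
  have := h.integral_by_parts (u := fun t => t) (u' := fun _ => 1) hasDerivAt_id continuous_const
    x y
  rw [intervalIntegral.integral_of_le hxy] at this
  rw [← neg_sub, ← this, ← integral_neg]
  congr 1 with t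
  ring

lemma HasValueDensity.integrableOn_revenue (h : HasValueDensity μ f) (x y : ℝ) :
    IntegrableOn (fun t => t * f t - survival μ t) (Ioc x y) := by
  have := (h.intervalIntegrable_parts (u := fun t => t) (u' := fun _ => 1) continuous_id
    continuous_const x y).1.neg
  refine this.congr (ae_of_all _ fun t => ?_)
  simp

/-- The loss of revenue from x to y is the integral of tf - (1 - F). This integrand is the virtual
value times f where f > 0, and is nonpositive where f = 0. -/
lemma revenue_le_add_lintegral (h : HasValueDensity μ f) {x y : ℝ} (hxy : x ≤ y) :
    ENNReal.ofReal (x * survival μ x) ≤ ENNReal.ofReal (y * survival μ y) +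
      ∫⁻ t in Ici x, ENNReal.ofReal (virtualValue μ f t) ∂μ := by
  have h1 : x * survival μ x = y * survival μ y +
      ∫ t in Ioc x y, (t * f t - survival μ t) := by
    rw [← h.revenue_sub hxy]; ring
  rw [h1]
  refine ENNReal.ofReal_add_le.trans (add_le_add le_rfl ?_)
  refine (ofReal_integral_le_lintegral (h.integrableOn_revenue x y)).trans ?_
  rw [h.setLIntegral_eq h.measurable_virtualValue.ennreal_ofReal measurableSet_Ici]
  refine (lintegral_mono_set Ioc_subset_Icc_self).trans
    ((lintegral_mono_set Icc_subset_Ici_self).trans (lintegral_mono fun t => ?_))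
  rw [← ENNReal.ofReal_mul' (h.nonneg t)]
  rcases (h.nonneg t).lt_or_eq with hf | hf
  · refine ENNReal.ofReal_le_ofReal ?_
    rw [survival_eq_of_density_pos hf]
    linarith
  · rw [← hf]
    simpa using survival_nonneg μ t

/-- Selling at a price `x` earns at most the virtual surplus above `x` and the revenue at
infinity. -/
theorem revenue_le_revenueAtInfinity_add (h : HasValueDensity μ f) (x : ℝ) :
    ENNReal.ofReal (x * survival μ x) ≤ revenueAtInfinity μ +
      ∫⁻ t in Ici x, ENNReal.ofReal (virtualValue μ f t) ∂μ := by
  rw [← tsub_le_iff_right]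
  refine le_liminf_of_le (by isBoundedDefault) ?_
  filter_upwards [eventually_ge_atTop x] with y hy
  rw [tsub_le_iff_right]
  exact revenue_le_add_lintegral h hy

/-- Nonnegative virtual values turn the previous inequality into an equality on every bounded
interval. For fixed n, the integral up to x + n plus the revenue at any y ≥ x + n is then at most
the revenue at x; y tends to infinity first, then n. -/
lemma revenueAtInfinity_add_le_of_nonneg (h : HasValueDensity μ f) {x : ℝ} (hx : 0 ≤ x)
    (hφ : ∀ t, x < t → 0 ≤ virtualValue μ f t ∧
      virtualValue μ f t * f t = t * f t - survival μ t) :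
    revenueAtInfinity μ + ∫⁻ t in Ioi x, ENNReal.ofReal (virtualValue μ f t) ∂μ ≤
      ENNReal.ofReal (x * survival μ x) := by
  have hfin : ∀ y, x ≤ y → ENNReal.ofReal (y * survival μ y) +
      ∫⁻ t in Ioc x y, ENNReal.ofReal (virtualValue μ f t) ∂μ =
      ENNReal.ofReal (x * survival μ x) := by
    intro y hy
    rw [h.setLIntegral_eq h.measurable_virtualValue.ennreal_ofReal measurableSet_Ioc]
    have e : ∫⁻ t in Ioc x y, ENNReal.ofReal (virtualValue μ f t) * ENNReal.ofReal (f t) =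
        ∫⁻ t in Ioc x y, ENNReal.ofReal (t * f t - survival μ t) := by
      refine setLIntegral_congr_fun measurableSet_Ioc fun t ht => ?_
      rw [← (hφ t ht.1).2, ENNReal.ofReal_mul (hφ t ht.1).1]
    have hnn : 0 ≤ᵐ[volume.restrict (Ioc x y)] fun t => t * f t - survival μ t := by
      refine (ae_restrict_iff' measurableSet_Ioc).2 (ae_of_all _ fun t ht => ?_)
      have := mul_nonneg (hφ t ht.1).1 (h.nonneg t)
      rwa [(hφ t ht.1).2] at this
    rw [e, ← ofReal_integral_eq_lintegral_ofReal (h.integrableOn_revenue x y) hnn,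
      ← ENNReal.ofReal_add (mul_nonneg (hx.trans hy) (survival_nonneg _ _))
        (integral_nonneg_of_ae hnn), ← h.revenue_sub hy]
    congr 1
    ring
  have hU : Ioi x = ⋃ n : ℕ, Ioc x (x + n) := by
    ext t
    simp only [mem_Ioi, mem_iUnion, mem_Ioc]
    refine ⟨fun ht => ?_, fun ⟨n, hn⟩ => hn.1⟩
    obtain ⟨n, hn⟩ := exists_nat_ge (t - x)
    exact ⟨n, ht, by linarith⟩
  have hdir : Directed (· ⊆ ·) fun n : ℕ => Ioc x (x + n) :=
    (monotone_nat_of_le_succ fun n => Ioc_subset_Ioc_right (by push_cast; linarith)).directed_le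
  rw [hU, setLIntegral_iUnion_of_directed _ hdir, ENNReal.add_iSup]
  refine iSup_le fun n => ?_
  rw [← ENNReal.le_sub_iff_add_le_right
    (ne_top_of_le_ne_top ENNReal.ofReal_ne_top (le_add_self.trans (hfin (x + n) (by simp)).le))
    (le_add_self.trans (hfin (x + n) (by simp)).le)]
  refine liminf_le_of_frequently_le' (Eventually.frequently ?_)
  filter_upwards [eventually_ge_atTop (x + n)] with y hy
  have hxy : x ≤ y := le_trans (by simp) hy
  refine ENNReal.le_sub_of_add_le_right
    (ne_top_of_le_ne_top ENNReal.ofReal_ne_top (le_add_self.trans (hfin (x + n) (by simp)).le)) ?_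
  rw [← hfin y hxy]
  exact add_le_add le_rfl (lintegral_mono_set (Ioc_subset_Ioc_right hy))

/-- The virtual surplus above `T` and the revenue at infinity together are at most the optimal
revenue of a price that is at least `T`. -/
theorem revenueAtInfinity_add_le (h : HasValueDensity μ f)
    (hpos : ∀ x, 0 < cdf μ x → cdf μ x < 1 → 0 < f x)
    (hmono : MonotoneOn (virtualValue μ f) {x | 0 < cdf μ x ∧ cdf μ x < 1})
    {T : ℝ} (hT : 0 ≤ T) {Z : ENNReal}
    (hZ : ∀ p, T ≤ p → ENNReal.ofReal (p * survival μ p) ≤ Z) :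
    revenueAtInfinity μ + ∫⁻ t in Ici T, ENNReal.ofReal (virtualValue μ f t) ∂μ ≤ Z := by
  have hns := h.nullSingletonClass
  -- The infimum of this set is the best price above T. The condition F > 0 excludes points below
  -- the support, where division by f = 0 gives the spurious virtual value x.
  set S := {x | T ≤ x ∧ 0 < cdf μ x ∧ 0 ≤ virtualValue μ f x} with hS
  have hzero : ∀ A : Set ℝ, MeasurableSet A → (∀ t ∈ A, T ≤ t) → (∀ t ∈ A, t ∉ S) →
      ∫⁻ t in A, ENNReal.ofReal (virtualValue μ f t) ∂μ = 0 := by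
    intro A hA hAT hAS
    rw [lintegral_eq_zero_iff h.measurable_virtualValue.ennreal_ofReal, Filter.EventuallyEq,
      ae_restrict_iff' hA]
    filter_upwards [h.ae_cdf_pos] with t ht htA
    have : ¬ 0 ≤ virtualValue μ f t := fun hv => hAS t htA ⟨hAT t htA, ht, hv⟩
    exact ENNReal.ofReal_eq_zero.2 (not_le.1 this).le
  rcases S.eq_empty_or_nonempty with hE | hne
  · rw [hzero _ measurableSet_Ici (fun t ht => ht) (by simp [hE]), add_zero]
    refine liminf_le_of_frequently_le' (Eventually.frequently ?_)
    filter_upwards [eventually_ge_atTop T] with y hy using hZ y hy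
  · have hbdd : BddBelow S := ⟨T, fun x hx => hx.1⟩
    have hTp : T ≤ sInf S := le_csInf hne fun x hx => hx.1
    refine le_trans ?_ (hZ (sInf S) hTp)
    rw [← Ico_union_Ici_eq_Ici hTp, lintegral_union measurableSet_Ici (by
        rw [Set.disjoint_left]; intro t ht ht'; exact absurd ht.2 (not_lt.2 ht')),
      hzero _ measurableSet_Ico (fun t ht => ht.1)
        (fun t ht htS => absurd ht.2 (not_lt.2 (csInf_le hbdd htS))), zero_add,
      setLIntegral_congr Ioi_ae_eq_Ici.symm]
    refine revenueAtInfinity_add_le_of_nonneg h (hT.trans hTp) fun t ht => ?_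
    obtain ⟨s, hs, hst⟩ := exists_lt_of_csInf_lt hne ht
    have h0 : 0 < cdf μ t := hs.2.1.trans_le (monotone_cdf μ hst.le)
    rcases (cdf_le_one μ t).lt_or_eq with h1 | h1
    · refine ⟨hs.2.2.trans (hmono ⟨hs.2.1, (monotone_cdf μ hst.le).trans_lt h1⟩ ⟨h0, h1⟩ hst.le),
        ?_⟩
      rw [survival_eq_of_density_pos (hpos t h0 h1)]
      ring
    · have hst0 : survival μ t = 0 := by rw [survival, h1, sub_self]
      have hv : virtualValue μ f t = t := by rw [virtualValue, h1, sub_self, zero_div, sub_zero]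
      rw [hv, hst0, sub_zero]
      exact ⟨hT.trans (hs.1.trans hst.le), rfl⟩

/-- The positive part of the virtual value is monotone on the support. -/
lemma ofReal_virtualValue_le (h : HasValueDensity μ f)
    (hmono : MonotoneOn (virtualValue μ f) {x | 0 < cdf μ x ∧ cdf μ x < 1})
    {x y : ℝ} (hx : 0 < cdf μ x) (hxy : x ≤ y) :
    ENNReal.ofReal (virtualValue μ f x) ≤ ENNReal.ofReal (virtualValue μ f y) := by
  refine ENNReal.ofReal_le_ofReal ?_
  have hy : 0 < cdf μ y := hx.trans_le (monotone_cdf μ hxy)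
  rcases (cdf_le_one μ y).lt_or_eq with h1 | h1
  · exact hmono ⟨hx, (monotone_cdf μ hxy).trans_lt h1⟩ ⟨hy, h1⟩ hxy
  · have hv : virtualValue μ f y = y := by rw [virtualValue, h1, sub_self, zero_div, sub_zero]
    rw [hv]
    exact (virtualValue_le h x).trans hxy

/-! ### Welfare and revenue for monotone hazard rates -/

lemma density_eq_hazardRate_mul {x : ℝ} (hx : cdf μ x < 1) :
    f x = hazardRate μ f x * survival μ x := by
  rw [hazardRate, survival, div_mul_cancel₀ _ (sub_pos.2 hx).ne']

lemma HasValueDensity.exists_cdf_mem_Ioo (h : HasValueDensity μ f) :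
    ∃ x, 0 < x ∧ 0 < cdf μ x ∧ cdf μ x < 1 := by
  obtain ⟨b, hb⟩ := ((tendsto_cdf_atTop μ).eventually (lt_mem_nhds one_half_lt_one)).exists
  obtain ⟨x, hx, hxe⟩ : (1 / 2 : ℝ) ∈ cdf μ '' Icc 0 b := by
    refine intermediate_value_Icc ?_ h.continuous_cdf.continuousOn ⟨?_, hb.le⟩
    · by_contra! hneg
      have := monotone_cdf μ hneg.le
      rw [h.cdf_zero] at this
      linarith
    · rw [h.cdf_zero]; norm_num
  refine ⟨x, hx.1.lt_of_ne fun h0 => ?_, by rw [hxe]; norm_num, by rw [hxe]; norm_num⟩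
  rw [← h0, h.cdf_zero] at hxe
  norm_num at hxe

lemma hasDerivAt_exp_div (p x : ℝ) :
    HasDerivAt (fun t => Real.exp (t / p)) (Real.exp (x / p) * (1 / p)) x :=
  ((hasDerivAt_id x).div_const p).exp

lemma continuous_exp_div_mul (p : ℝ) : Continuous fun x => Real.exp (x / p) * (1 / p) := by
  fun_prop

/-- A price `p ≥ T` from which the survival function decays exponentially with mean `p`. -/
lemma IsMHR.exists_price (h : HasValueDensity μ f)
    (hm : MonotoneOn (hazardRate μ f) {x | cdf μ x < 1}) {T : ℝ} (hT : 0 ≤ T) :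
    ∃ p, T ≤ p ∧ 0 < p ∧
      ∀ t, T ≤ t → Real.exp (t / p) * survival μ t ≤ Real.exp 1 * survival μ p := by
  obtain ⟨x₀, hx₀, h0, h1⟩ := h.exists_cdf_mem_Ioo
  have hf₀ := IsMHR.density_pos h hm h0 h1
  have hh₀ : 0 < hazardRate μ f x₀ := div_pos hf₀ (sub_pos.2 h1)
  set S := insert T {x | T ≤ x ∧ cdf μ x < 1 ∧ x * hazardRate μ f x < 1} with hS
  have hSne : S.Nonempty := ⟨T, mem_insert _ _⟩
  have hSbdd : BddAbove S := by
    refine ⟨max T (max x₀ (1 / hazardRate μ f x₀)), ?_⟩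
    rintro x (rfl | ⟨hTx, hx1, hx⟩)
    · exact le_max_left _ _
    · by_contra! hlt
      have hx0x : x₀ < x := (le_max_left _ _).trans_lt ((le_max_right _ _).trans_lt hlt)
      have h2 : 1 / hazardRate μ f x₀ < x :=
        (le_max_right _ _).trans_lt ((le_max_right _ _).trans_lt hlt)
      rw [div_lt_iff₀ hh₀] at h2
      have h3 := hm h1 hx1 hx0x.le
      have := mul_le_mul_of_nonneg_left h3 (hx₀.trans hx0x).le
      linarith
  set p := sSup S with hp
  have hTp : T ≤ p := le_csSup hSbdd (mem_insert _ _)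
  have hp0 : 0 < p := by
    rcases hT.lt_or_eq with hT0 | hT0
    · exact hT0.trans_le hTp
    -- For T = 0 positivity of p needs a positive member of S; near 0 the hazard rate is at most its
    -- value at `x₀`, so y·h(y) < 1.
    · set y := min x₀ (1 / (hazardRate μ f x₀ + 1)) with hy
      have hy0 : 0 < y := lt_min hx₀ (by positivity)
      have hyx : y ≤ x₀ := min_le_left _ _
      have hy1 : cdf μ y < 1 := (monotone_cdf μ hyx).trans_lt h1
      have hyS : y ∈ S := by
        refine mem_insert_of_mem _ ⟨hT0 ▸ hy0.le, hy1, ?_⟩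
        have h2 := hm hy1 h1 hyx
        have h3 : y ≤ 1 / (hazardRate μ f x₀ + 1) := min_le_right _ _
        rw [le_div_iff₀ (by linarith)] at h3
        have := mul_le_mul_of_nonneg_left h2 hy0.le
        linarith
      exact hy0.trans_le (le_csSup hSbdd hyS)
  refine ⟨p, hTp, hp0, fun t ht => ?_⟩
  have hpp : Real.exp 1 = Real.exp (p / p) := by rw [div_self hp0.ne']
  rw [hpp]
  rcases le_total t p with htp | hpt
  · refine h.le_mul_survival_of_ae (u := fun t => Real.exp (t / p))
      (hasDerivAt_exp_div p) (continuous_exp_div_mul p) htp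
      (ae_of_all _ fun s hs => ?_)
    have hTs : T ≤ s := ht.trans hs.1.le
    have hex : ∀ η, s ≤ η → η < p → ∃ q ∈ S, η < q ∧ cdf μ q < 1 ∧ q * hazardRate μ f q < 1 := by
      intro η hsη hη
      obtain ⟨q, hq, hηq⟩ := exists_lt_of_lt_csSup hSne hη
      rcases hq with rfl | hq
      · exact absurd (hTs.trans hsη) (not_le.2 hηq)
      · exact ⟨q, mem_insert_of_mem _ hq, hηq, hq.2⟩
    obtain ⟨q₀, -, hq₀, hq₀1, -⟩ := hex s le_rfl hs.2
    have hs1 : cdf μ s < 1 := (monotone_cdf μ hq₀.le).trans_lt hq₀1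
    have hhs : 0 ≤ hazardRate μ f s := div_nonneg (h.nonneg s) (sub_pos.2 hs1).le
    have hb : hazardRate μ f s ≤ 1 / p := by
      rw [le_div_iff₀ hp0]
      by_contra! hlt
      have hh : 0 < hazardRate μ f s := hhs.lt_of_ne fun h' => by
        rw [← h'] at hlt; linarith
      have h2 : 1 / hazardRate μ f s < p := by
        rw [div_lt_iff₀ hh]; linarith
      obtain ⟨q, -, hq, hq1, hqh⟩ := hex (max s (1 / hazardRate μ f s)) (le_max_left _ _)
        (max_lt hs.2 h2)
      have hsq : s < q := (le_max_left _ _).trans_lt hq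
      have h3 : 1 / hazardRate μ f s < q := (le_max_right _ _).trans_lt hq
      rw [div_lt_iff₀ hh] at h3
      have := mul_le_mul_of_nonneg_left (hm hs1 hq1 hsq.le) (hT.trans (hTs.trans hsq.le))
      linarith
    rw [density_eq_hazardRate_mul (f := f) hs1, mul_assoc]
    exact mul_le_mul_of_nonneg_left (mul_le_mul_of_nonneg_right hb (survival_nonneg _ _))
      (Real.exp_pos _).le
  · refine h.mul_survival_le_of_ae (u := fun t => Real.exp (t / p))
      (hasDerivAt_exp_div p) (continuous_exp_div_mul p) hpt
      (ae_of_all _ fun s hs => ?_)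
    rcases (cdf_le_one μ s).lt_or_eq with hs1 | hs1
    swap
    · rw [survival, hs1, sub_self, mul_zero]
      exact mul_nonneg (Real.exp_pos _).le (h.nonneg s)
    have hb : 1 / p ≤ hazardRate μ f s := by
      rw [div_le_iff₀ hp0]
      by_contra! hlt
      have hhs : 0 ≤ hazardRate μ f s := div_nonneg (h.nonneg s) (sub_pos.2 hs1).le
      obtain ⟨q, hpq, hqs, hq⟩ : ∃ q, p < q ∧ q < s ∧ q * hazardRate μ f s < 1 := by
        have hc : ContinuousAt (fun q => q * hazardRate μ f s) p := by fun_prop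
        have hev := hc.eventually (gt_mem_nhds (by linarith : p * hazardRate μ f s < 1))
        have hev' := (hev.filter_mono nhdsWithin_le_nhds : ∀ᶠ q in 𝓝[>] p, _).and
          (Ioo_mem_nhdsGT hs.1)
        obtain ⟨q, h2, h3⟩ := hev'.exists
        exact ⟨q, h3.1, h3.2, h2⟩
      have hq1 : cdf μ q < 1 := (monotone_cdf μ hqs.le).trans_lt hs1
      have h2 := mul_le_mul_of_nonneg_left (hm hq1 hs1 hqs.le) (hp0.trans hpq).le
      exact absurd (le_csSup hSbdd (mem_insert_of_mem _ ⟨hTp.trans hpq.le, hq1, h2.trans_lt hq⟩))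
        (not_le.2 hpq)
    rw [density_eq_hazardRate_mul (f := f) hs1, mul_assoc]
    exact mul_le_mul_of_nonneg_left (mul_le_mul_of_nonneg_right hb (survival_nonneg _ _))
      (Real.exp_pos _).le

lemma integral_exp_neg_div {p : ℝ} (hp : 0 < p) (x y : ℝ) :
    ∫ t in x..y, Real.exp (-(t / p)) = p * Real.exp (-(x / p)) - p * Real.exp (-(y / p)) := by
  have hd : ∀ t ∈ uIcc x y,
      HasDerivAt (fun t => -(p * Real.exp (-(t / p)))) (Real.exp (-(t / p))) t := by
    intro t _
    have := (((hasDerivAt_id t).div_const p).neg.exp.const_mul p).neg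
    refine HasDerivAt.congr_deriv this ?_
    change -(p * (Real.exp (-(t / p)) * -(1 / p))) = _
    field_simp
  rw [intervalIntegral.integral_eq_sub_of_hasDerivAt hd
    (Continuous.intervalIntegrable (by fun_prop) _ _)]
  ring

/-- The welfare of the sales to values above `T` is at most `e` times the optimal revenue of a
price that is at least `T`. -/
theorem IsMHR.lintegral_le (hμ : IsMHR μ) {T : ℝ} (hT : 0 ≤ T) {Z : ENNReal}
    (hZ : ∀ p, T ≤ p → ENNReal.ofReal (p * survival μ p) ≤ Z) :
    ∫⁻ x in Ici T, ENNReal.ofReal x ∂μ ≤ ENNReal.ofReal (Real.exp 1) * Z := by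
  obtain ⟨f, h, hm⟩ := hμ
  have hns := h.nullSingletonClass
  obtain ⟨p, hTp, hp, hdec⟩ := IsMHR.exists_price h hm hT
  refine le_trans ?_ (mul_le_mul_right (hZ p hTp) _)
  rw [← ENNReal.ofReal_mul (Real.exp_pos _).le, setLIntegral_congr Ioi_ae_eq_Ici.symm]
  have hdec' : ∀ t, T ≤ t →
      survival μ t ≤ Real.exp 1 * survival μ p * Real.exp (-(t / p)) := by
    intro t ht
    have := mul_le_mul_of_nonneg_right (hdec t ht) (Real.exp_pos (-(t / p))).le
    rwa [mul_right_comm, ← Real.exp_add, add_neg_cancel, Real.exp_zero, one_mul] at this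
  have hK : 0 ≤ Real.exp 1 * survival μ p := mul_nonneg (Real.exp_pos _).le (survival_nonneg _ _)
  have hfin : ∀ y, T ≤ y → ∫⁻ t in Ioc T y, ENNReal.ofReal t ∂μ ≤
      ENNReal.ofReal (Real.exp 1 * (p * survival μ p)) := by
    intro y hy
    rw [h.setLIntegral_eq (g := fun t => ENNReal.ofReal t) ENNReal.measurable_ofReal
      measurableSet_Ioc]
    have hint : IntervalIntegrable (fun t => t * f t) volume T y :=
      h.integrable.intervalIntegrable.continuousOn_mul continuous_id.continuousOn
    have hG : IntervalIntegrable (survival μ) volume T y :=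
      h.continuous_survival.intervalIntegrable _ _
    have e : ∫⁻ t in Ioc T y, ENNReal.ofReal t * ENNReal.ofReal (f t) =
        ENNReal.ofReal (∫ t in Ioc T y, t * f t) := by
      rw [ofReal_integral_eq_lintegral_ofReal hint.1 ((ae_restrict_iff' measurableSet_Ioc).2
        (ae_of_all _ fun t ht => mul_nonneg (hT.trans ht.1.le) (h.nonneg t)))]
      refine setLIntegral_congr_fun measurableSet_Ioc fun t ht => ?_
      rw [ENNReal.ofReal_mul (hT.trans ht.1.le)]
    refine e.le.trans (ENNReal.ofReal_le_ofReal ?_)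
    have h1 := h.integral_by_parts (u := fun t => t) (u' := fun _ => 1) hasDerivAt_id
      continuous_const T y
    simp only [one_mul] at h1
    rw [intervalIntegral.integral_sub hG hint] at h1
    have h2 : ∫ t in T..y, survival μ t ≤
        ∫ t in T..y, Real.exp 1 * survival μ p * Real.exp (-(t / p)) :=
      intervalIntegral.integral_mono_on hy hG (Continuous.intervalIntegrable (by fun_prop) _ _)
        fun t ht => hdec' t ht.1
    rw [intervalIntegral.integral_const_mul, integral_exp_neg_div hp] at h2
    have h3 := mul_le_mul_of_nonneg_left (hdec' T le_rfl) hT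
    have h4 : 0 ≤ y * survival μ y := mul_nonneg (hT.trans hy) (survival_nonneg _ _)
    have h5 : 0 ≤ Real.exp 1 * survival μ p * (p * Real.exp (-(y / p))) :=
      mul_nonneg hK (mul_nonneg hp.le (Real.exp_pos _).le)
    -- By parts, the welfare above T is at most T(1 - F(T)) plus the integral of the tail, hence at
    -- most e(1 - F(p))·(T + p)·exp(-T/p). The inequality 1 + T/p ≤ exp(T/p) removes T.
    have h6 : (T + p) * Real.exp (-(T / p)) ≤ p := by
      have h7 := Real.add_one_le_exp (T / p)
      have h8 : T + p ≤ p * Real.exp (T / p) := by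
        have := mul_le_mul_of_nonneg_left h7 hp.le
        rwa [mul_add, mul_div_cancel₀ _ hp.ne', mul_one] at this
      have := mul_le_mul_of_nonneg_right h8 (Real.exp_pos (-(T / p))).le
      rwa [mul_assoc, ← Real.exp_add, add_neg_cancel, Real.exp_zero, mul_one] at this
    have h9 := mul_le_mul_of_nonneg_left h6 hK
    rw [← intervalIntegral.integral_of_le hy]
    nlinarith
  have hU : Ioi T = ⋃ n : ℕ, Ioc T (T + n) := by
    ext t
    simp only [mem_Ioi, mem_iUnion, mem_Ioc]
    refine ⟨fun ht => ?_, fun ⟨n, hn⟩ => hn.1⟩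
    obtain ⟨n, hn⟩ := exists_nat_ge (t - T)
    exact ⟨n, ht, by linarith⟩
  have hdir : Directed (· ⊆ ·) fun n : ℕ => Ioc T (T + n) :=
    (monotone_nat_of_le_succ fun n => Ioc_subset_Ioc_right (by push_cast; linarith)).directed_le
  rw [hU, setLIntegral_iUnion_of_directed _ hdir]
  exact iSup_le fun n => hfin _ (by simp)

end Distributions

/-! ### Independence in product measures -/

section Product

variable {ι : Type*} [Fintype ι] [DecidableEq ι] (D : ι → Measure ℝ)
  [∀ e, IsProbabilityMeasure (D e)] {N : ℕ}

/-- Resampling one coordinate does not change a product measure. -/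
lemma measurePreserving_update (e : ι) :
    MeasurePreserving (fun q : (ι → ℝ) × ℝ => Function.update q.1 e q.2)
      ((Measure.pi D).prod (D e)) (Measure.pi D) := by
  have hm : Measurable fun q : (ι → ℝ) × ℝ => Function.update q.1 e q.2 := by
    refine measurable_pi_iff.2 fun f => ?_
    by_cases hf : f = e
    · subst hf; simpa using measurable_snd
    · simp only [Function.update_of_ne hf]
      fun_prop
  refine ⟨hm, (Measure.pi_eq fun s hs => ?_).symm⟩
  rw [Measure.map_apply hm (MeasurableSet.univ_pi hs)]
  have : (fun q : (ι → ℝ) × ℝ => Function.update q.1 e q.2) ⁻¹' univ.pi s =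
      (univ.pi (Function.update s e univ)) ×ˢ s e := by
    ext q
    simp only [mem_preimage, mem_univ_pi, mem_prod]
    constructor
    · refine fun h => ⟨fun f => ?_, by simpa using h e⟩
      by_cases hf : f = e
      · subst hf; simp
      · simpa [Function.update_of_ne hf] using h f
    · rintro ⟨h1, h2⟩ f
      by_cases hf : f = e
      · subst hf; simpa using h2
      · simpa [Function.update_of_ne hf] using h1 f
  rw [this, Measure.prod_prod, Measure.pi_pi, ← Finset.prod_erase_mul _ _ (Finset.mem_univ e),
    ← Finset.prod_erase_mul (a := e) Finset.univ (fun i => D i (s i)) (Finset.mem_univ e)]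
  simp only [Function.update_self, measure_univ, mul_one]
  congr 1
  refine Finset.prod_congr rfl fun f hf => ?_
  rw [Function.update_of_ne (Finset.ne_of_mem_erase hf)]

lemma lintegral_pi_eq_update (e : ι) {g : (ι → ℝ) → ENNReal} (hg : Measurable g) :
    ∫⁻ v, g v ∂Measure.pi D =
      ∫⁻ v, ∫⁻ x, g (Function.update v e x) ∂D e ∂Measure.pi D := by
  rw [← (measurePreserving_update D e).lintegral_comp hg]
  exact lintegral_prod _ (hg.comp (measurePreserving_update D e).measurable).aemeasurable

/-- The joint law of the samples and the values. -/
abbrev sampleLaw (D : ι → Measure ℝ) (N : ℕ) : Measure ((Fin N → ι → ℝ) × (ι → ℝ)) :=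
  (Measure.pi fun _ : Fin N => Measure.pi D).prod (Measure.pi D)

/-- All coordinates of the samples and the values; the values have the index `none`. -/
def coord (q : (Fin N → ι → ℝ) × (ι → ℝ)) (x : Option (Fin N) × ι) : ℝ :=
  x.1.elim (q.2 x.2) fun k => q.1 k x.2

/-- The samples and the values with given coordinates. -/
def ofCoord (w : Option (Fin N) × ι → ℝ) : (Fin N → ι → ℝ) × (ι → ℝ) :=
  (fun k e => w (some k, e), fun e => w (none, e))

lemma measurable_coord : Measurable (coord : (Fin N → ι → ℝ) × (ι → ℝ) → _) := by
  refine measurable_pi_iff.2 fun ⟨o, e⟩ => ?_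
  cases o <;> simp only [coord, Option.elim] <;> fun_prop

lemma measurable_ofCoord : Measurable (ofCoord : _ → (Fin N → ι → ℝ) × (ι → ℝ)) := by
  unfold ofCoord; fun_prop

lemma map_coord : (sampleLaw D N).map coord = Measure.pi fun x : Option (Fin N) × ι => D x.2 := by
  refine (Measure.pi_eq fun s hs => ?_).symm
  rw [Measure.map_apply measurable_coord (MeasurableSet.univ_pi hs)]
  have : coord ⁻¹' univ.pi s =
      (univ.pi fun k : Fin N => univ.pi fun e => s (some k, e)) ×ˢ univ.pi fun e => s (none, e) := by
    ext q
    simp only [mem_preimage, mem_univ_pi, mem_prod]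
    constructor
    · exact fun h => ⟨fun k e => h (some k, e), fun e => h (none, e)⟩
    · rintro ⟨h1, h2⟩ ⟨o, e⟩
      cases o with
      | none => exact h2 e
      | some k => exact h1 k e
  rw [this, Measure.prod_prod, Measure.pi_pi, Measure.pi_pi, Fintype.prod_prod_type,
    Fintype.prod_option, mul_comm]
  simp only [Measure.pi_pi]

lemma iIndepFun_coord :
    iIndepFun (fun (x : Option (Fin N) × ι) q => coord q x) (sampleLaw D N) := by
  refine iIndepFun_iff_map_fun_eq_pi_map
    (fun x => (measurable_pi_iff.1 measurable_coord x).aemeasurable) |>.2 ?_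
  have h : ∀ x, (sampleLaw D N).map (fun q => coord q x) = D x.2 := by
    intro x
    rw [← (measurePreserving_eval (fun x : Option (Fin N) × ι => D x.2) x).map_eq, ← map_coord,
      Measure.map_map (measurable_pi_apply x) measurable_coord]
    rfl
  simp only [h]
  exact map_coord D

/-- Functions of disjoint sets of coordinates are independent. -/
lemma lintegral_mul_of_disjoint_coord (J : Set (Option (Fin N) × ι))
    {F H : (Fin N → ι → ℝ) × (ι → ℝ) → ENNReal} (hF : Measurable F) (hH : Measurable H)
    (hFJ : ∀ p q, (∀ x ∈ J, coord p x = coord q x) → F p = F q)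
    (hHJ : ∀ p q, (∀ x ∉ J, coord p x = coord q x) → H p = H q) :
    ∫⁻ q, F q * H q ∂sampleLaw D N = (∫⁻ q, F q ∂sampleLaw D N) * ∫⁻ q, H q ∂sampleLaw D N := by
  classical
  -- Filling the missing coordinates with 0 exhibits F and H as functions of complementary finite
  -- families of independent coordinates.
  have hext : ∀ S : Finset (Option (Fin N) × ι), Measurable fun y : S → ℝ =>
      (ofCoord (fun x => if h : x ∈ S then y ⟨x, h⟩ else 0) : (Fin N → ι → ℝ) × (ι → ℝ)) := by
    intro S
    refine measurable_ofCoord.comp (measurable_pi_iff.2 fun x => ?_)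
    by_cases h : x ∈ S
    · simpa [h] using measurable_pi_apply _
    · simp [h]
  have hco : ∀ w x, coord (ofCoord w : (Fin N → ι → ℝ) × (ι → ℝ)) x = w x := by
    rintro w ⟨o, e⟩
    cases o <;> rfl
  have hind := (iIndepFun_coord (N := N) D).indepFun_finset J.toFinset Jᶜ.toFinset
    (by rw [Set.toFinset_compl]; exact disjoint_compl_right)
    (fun x => measurable_pi_iff.1 measurable_coord x)
  have h2 := hind.comp (hF.comp (hext J.toFinset)) (hH.comp (hext Jᶜ.toFinset))
  have eF : (F ∘ fun y : J.toFinset → ℝ =>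
      (ofCoord (fun x => if h : x ∈ J.toFinset then y ⟨x, h⟩ else 0) :
        (Fin N → ι → ℝ) × (ι → ℝ))) ∘ (fun a (i : J.toFinset) => coord a i) = F := by
    funext q
    refine hFJ _ _ fun x hx => ?_
    rw [hco]
    simp [hx]
  have eH : (H ∘ fun y : Jᶜ.toFinset → ℝ =>
      (ofCoord (fun x => if h : x ∈ Jᶜ.toFinset then y ⟨x, h⟩ else 0) :
        (Fin N → ι → ℝ) × (ι → ℝ))) ∘ (fun a (i : Jᶜ.toFinset) => coord a i) = H := by
    funext q
    refine hHJ _ _ fun x hx => ?_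
    rw [hco]
    simp [hx]
  rw [eF, eH] at h2
  exact lintegral_mul_eq_lintegral_mul_lintegral_of_indepFun hF hH h2

/-- Two different samples and the values. -/
lemma measurePreserving_sample_pair {k l : Fin N} (hkl : k ≠ l) (e : ι) :
    MeasurePreserving (fun q : (Fin N → ι → ℝ) × (ι → ℝ) => ((q.1 k, q.1 l e), q.2 e))
      (sampleLaw D N) (((Measure.pi D).prod (D e)).prod (D e)) := by
  have h1 : MeasurePreserving (fun s : Fin N → ι → ℝ => (s k, s l))
      (Measure.pi fun _ => Measure.pi D) ((Measure.pi D).prod (Measure.pi D)) := by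
    refine ⟨by fun_prop, ?_⟩
    have hi : IndepFun (fun s : Fin N → ι → ℝ => s k) (fun s => s l)
        (Measure.pi fun _ => Measure.pi D) :=
      (iIndepFun_pi (μ := fun _ : Fin N => Measure.pi D) (X := fun _ => id)
        fun _ => aemeasurable_id).indepFun hkl
    rw [(indepFun_iff_map_prod_eq_prod_map_map (measurable_pi_apply k).aemeasurable
      (measurable_pi_apply l).aemeasurable).1 hi]
    congr 1
    · exact (measurePreserving_eval (fun _ : Fin N => Measure.pi D) k).map_eq
    · exact (measurePreserving_eval (fun _ : Fin N => Measure.pi D) l).map_eq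
  have h2 := ((MeasurePreserving.id (Measure.pi D)).prod (measurePreserving_eval D e)).comp h1
  exact h2.prod (measurePreserving_eval D e)

end Product

/-! ### Sequential posted prices -/

section Posted

variable {B I : Type*} [Fintype B] [DecidableEq B] [DecidableEq I] {G : Finset (B × I)}

/-- Two different edges that share a buyer or an item. -/
def Conflict (e e' : G) : Prop := e ≠ e' ∧ (e.1.1 = e'.1.1 ∨ e.1.2 = e'.1.2)

/-- The arrival order of the buyers: a fixed order or its reverse. -/
def Before (o : Bool) (i i' : B) : Prop :=
  if o then Fintype.equivFin B i < Fintype.equivFin B i'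
  else Fintype.equivFin B i' < Fintype.equivFin B i

lemma Before.ne {o : Bool} {i i' : B} (h : Before o i i') : i ≠ i' := by
  rintro rfl
  unfold Before at h
  split at h <;> exact lt_irrefl _ h

lemma before_or_before (o : Bool) {i i' : B} (h : i ≠ i') : Before o i i' ∨ Before o i' i := by
  have h' : Fintype.equivFin B i ≠ Fintype.equivFin B i' := (Fintype.equivFin B).injective.ne h
  unfold Before
  rcases lt_or_gt_of_ne h' with h1 | h1 <;> cases o <;> simp [h1]

lemma before_true_false {i i' : B} (h1 : Before true i i') (h2 : Before false i i') : False := by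
  simp only [Before, if_true, Bool.false_eq_true, if_false] at h1 h2
  exact lt_asymm h1 h2

/-- The internal randomness: which edges are on sale (those with value `0`), and the order of the
buyers. -/
abbrev Coins (G : Finset (B × I)) : Type _ := (G → Fin 3) × Bool

/-- With the utilities `u` the buyer would buy on the edge `e`, if it were offered. -/
def Wants (θ : Coins G) (u : Profile G) (e : G) : Prop := θ.1 e = 0 ∧ 0 ≤ u e

/-- The edge is on sale, and no earlier buyer wants its item. -/
def Offered (θ : Coins G) (u : Profile G) (e : G) : Prop :=
  θ.1 e = 0 ∧ ∀ e' : G, e'.1.2 = e.1.2 → Before θ.2 e'.1.1 e.1.1 → ¬ Wants θ u e'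

/-- The edge is an optimal purchase for its buyer. -/
def Best (θ : Coins G) (u : Profile G) (e : G) : Prop :=
  Offered θ u e ∧ 0 ≤ u e ∧ ∀ e' : G, e'.1.1 = e.1.1 → Offered θ u e' → u e' ≤ u e

/-- The edge is the first optimal purchase of its buyer. -/
def Chosen (θ : Coins G) (u : Profile G) (e : G) : Prop :=
  Best θ u e ∧ ∀ e' : G, e'.1.1 = e.1.1 → Best θ u e' →
    Fintype.equivFin G e ≤ Fintype.equivFin G e'

open Classical in
/-- The edges on which there is a sale. -/
def outcome (θ : Coins G) (u : Profile G) : Finset G := Finset.univ.filter (Chosen θ u)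

lemma mem_outcome {θ : Coins G} {u : Profile G} {e : G} : e ∈ outcome θ u ↔ Chosen θ u e := by
  simp [outcome]

lemma Chosen.wants {θ : Coins G} {u : Profile G} {e : G} (h : Chosen θ u e) : Wants θ u e :=
  ⟨h.1.1.1, h.1.2.1⟩

lemma Chosen.eq {θ : Coins G} {u : Profile G} {e e' : G} (h : Chosen θ u e) (h' : Chosen θ u e')
    (hb : e.1.1 = e'.1.1) : e = e' :=
  (Fintype.equivFin G).injective (le_antisymm (h.2 e' hb.symm h'.1) (h'.2 e hb h.1))

/-- An item is withdrawn as soon as an earlier buyer wants it, even if that buyer purchases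
something else, so no item is sold twice. This wasteful rule makes availability a condition on other
edges alone, without recursion over earlier purchases. -/
lemma isMatching_outcome (θ : Coins G) (u : Profile G) : IsMatching (outcome θ u) := by
  intro e he e' he' hne
  rw [mem_outcome] at he he'
  have hb : e.1.1 ≠ e'.1.1 := fun h => hne (he.eq he' h)
  refine ⟨hb, fun hi => ?_⟩
  rcases before_or_before θ.2 hb with h | h
  · exact he'.1.1.2 e hi h he.wants
  · exact he.1.1.2 e' hi.symm h he'.wants

/-- If no potential blocker is wanted, `e` is offered and is the only acceptable purchase of its
buyer, so the tie-breaking is irrelevant. -/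
lemma chosen_of_wants {θ : Coins G} {u : Profile G} {e : G} (h : Wants θ u e)
    (hb : ∀ e' : G, e' ≠ e → e'.1.1 = e.1.1 → ¬ Wants θ u e')
    (hi : ∀ e' : G, e'.1.2 = e.1.2 → Before θ.2 e'.1.1 e.1.1 → ¬ Wants θ u e') :
    Chosen θ u e := by
  refine ⟨⟨⟨h.1, hi⟩, h.2, fun e' he' ho => ?_⟩, fun e' he' hbest => ?_⟩
  · by_contra! hlt
    refine hb e' ?_ he' ⟨ho.1, h.2.trans hlt.le⟩
    rintro rfl
    exact lt_irrefl _ hlt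
  · by_contra! hlt
    refine hb e' ?_ he' ⟨hbest.1.1, hbest.2.1⟩
    rintro rfl
    exact lt_irrefl _ hlt

lemma exists_chosen {θ : Coins G} {u : Profile G} {e : G} (ho : Offered θ u e) (hu : 0 ≤ u e) :
    ∃ e' : G, e'.1.1 = e.1.1 ∧ Chosen θ u e' ∧ u e ≤ u e' := by
  classical
  obtain ⟨a, ha, hmax⟩ := Finset.exists_max_image
    (Finset.univ.filter fun e' : G => e'.1.1 = e.1.1 ∧ Offered θ u e') u ⟨e, by simp [ho]⟩
  simp only [Finset.mem_filter, Finset.mem_univ, true_and, and_imp] at ha hmax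
  have hea := hmax e rfl ho
  have hba : Best θ u a := ⟨ha.2, hu.trans hea, fun e' he' ho' => hmax e' (he'.trans ha.1) ho'⟩
  obtain ⟨c, hc, hmin⟩ := Finset.exists_min_image
    (Finset.univ.filter fun e' : G => e'.1.1 = e.1.1 ∧ Best θ u e') (Fintype.equivFin G)
    ⟨a, by simp [ha.1, hba]⟩
  simp only [Finset.mem_filter, Finset.mem_univ, true_and, and_imp] at hc hmin
  exact ⟨c, hc.1, ⟨hc.2, fun e' he' hb => hmin e' (he'.trans hc.1) hb⟩,
    hea.trans (hc.2.2.2 a (ha.1.trans hc.1.symm) ha.2)⟩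

open Classical in
lemma sum_chosen_nonneg (θ : Coins G) (u : Profile G) (i : B) :
    0 ≤ ∑ e ∈ Finset.univ.filter (fun e : G => e.1.1 = i), if Chosen θ u e then u e else 0 := by
  refine Finset.sum_nonneg fun e _ => ?_
  split_ifs with h
  · exact h.1.2.1
  · exact le_rfl

-- Truthfulness for fixed coins: the set of offers to buyer i depends only on other buyers, and a
-- truthful report buys the best offer of nonnegative utility.
open Classical in
lemma sum_chosen_le (θ : Coins G) {u u' : Profile G} (i : B)
    (huu : ∀ e : G, e.1.1 ≠ i → u' e = u e) :
    (∑ e ∈ Finset.univ.filter (fun e : G => e.1.1 = i), if Chosen θ u' e then u e else 0) ≤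
      ∑ e ∈ Finset.univ.filter (fun e : G => e.1.1 = i), if Chosen θ u e then u e else 0 := by
  by_cases hex : ∃ e : G, e.1.1 = i ∧ Chosen θ u' e
  swap
  · rw [Finset.sum_eq_zero fun e he => ?_]
    · exact sum_chosen_nonneg θ u i
    · rw [if_neg fun h => hex ⟨e, (Finset.mem_filter.1 he).2, h⟩]
  obtain ⟨e₀, rfl, h0⟩ := hex
  rw [Finset.sum_eq_single_of_mem e₀ (by simp) fun e he hne =>
    if_neg fun h => hne (h.eq h0 (Finset.mem_filter.1 he).2), if_pos h0]
  rcases lt_or_ge (u e₀) 0 with hneg | hnn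
  · exact hneg.le.trans (sum_chosen_nonneg θ u _)
  have ho : Offered θ u e₀ := by
    refine ⟨h0.1.1.1, fun e' he' hbf hw => h0.1.1.2 e' he' hbf ?_⟩
    rw [Wants, huu e' hbf.ne]
    exact hw
  obtain ⟨e₁, hb, h1, hle⟩ := exists_chosen ho hnn
  refine hle.trans ?_
  have hs := Finset.single_le_sum (f := fun e => if Chosen θ u e then u e else 0)
    (s := Finset.univ.filter fun e : G => e.1.1 = e₀.1.1)
    (fun e _ => by
      split_ifs with h
      · exact h.1.2.1
      · exact le_rfl) (Finset.mem_filter.2 ⟨Finset.mem_univ e₁, hb⟩)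
  simpa only [if_pos h1] using hs

lemma measurable_wants (θ : Coins G) (e : G) : Measurable fun u => Wants θ u e := by
  unfold Wants
  exact measurable_const.and
    (measurableSet_setOfPred.1 (measurableSet_le measurable_const (measurable_pi_apply e)))

lemma measurable_offered (θ : Coins G) (e : G) : Measurable fun u => Offered θ u e := by
  unfold Offered
  exact measurable_const.and (Measurable.forall fun e' => measurable_const.imp
    (measurable_const.imp (measurable_wants θ e').not))

lemma measurable_best (θ : Coins G) (e : G) : Measurable fun u => Best θ u e := by
  unfold Best
  exact (measurable_offered θ e).and
    ((measurableSet_setOfPred.1 (measurableSet_le measurable_const (measurable_pi_apply e))).and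
    (Measurable.forall fun e' => measurable_const.imp ((measurable_offered θ e').imp
      (measurableSet_setOfPred.1 (measurableSet_le (measurable_pi_apply e') (measurable_pi_apply e))))))

lemma measurableSet_chosen (θ : Coins G) (e : G) : MeasurableSet {u | Chosen θ u e} := by
  refine measurableSet_setOfPred.2 ?_
  unfold Chosen
  exact (measurable_best θ e).and (Measurable.forall fun e' => measurable_const.imp
    ((measurable_best θ e').imp measurable_const))

lemma measurableSet_outcome_eq (θ : Coins G) (S : Finset G) :
    MeasurableSet {u | outcome θ u = S} := by
  have : {u | outcome θ u = S} = ⋂ e : G, {u | Chosen θ u e ↔ e ∈ S} := by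
    ext u
    simp [Finset.ext_iff, mem_outcome]
  rw [this]
  refine MeasurableSet.iInter fun e => measurableSet_setOfPred.2 ?_
  exact (measurableSet_setOfPred.1 (measurableSet_chosen θ e)).iff measurable_const

open Classical in
/-- The mechanism that draws the coins uniformly and then sells at the prices `P`. -/
def postedPrices (P : Profile G) : Mechanism G where
  lottery b S := (Fintype.card (Coins G) : ℝ)⁻¹ *
    ∑ θ : Coins G, if outcome θ (b - P) = S then 1 else 0
  pay b i := (Fintype.card (Coins G) : ℝ)⁻¹ *
    ∑ θ : Coins G, ∑ e ∈ Finset.univ.filter (fun e : G => e.1.1 = i),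
      if Chosen θ (b - P) e then P e else 0
  lottery_nonneg b S := mul_nonneg (by positivity) (Finset.sum_nonneg fun θ _ => by
    split_ifs <;> norm_num)
  lottery_sum b := by
    rw [← Finset.mul_sum, Finset.sum_comm]
    simp only [Finset.sum_ite_eq, Finset.mem_univ, if_true, Finset.sum_const, Finset.card_univ,
      nsmul_eq_mul, mul_one]
    exact inv_mul_cancel₀ (Nat.cast_ne_zero.2 Fintype.card_ne_zero)
  lottery_feasible b S h := by
    obtain ⟨θ, -, hθ⟩ := Finset.exists_ne_zero_of_sum_ne_zero (right_ne_zero_of_mul h)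
    have : outcome θ (b - P) = S := by
      by_contra hne
      exact hθ (if_neg hne)
    exact this ▸ isMatching_outcome θ _
  measurable_lottery S := by
    refine (Finset.measurable_sum _ fun θ _ => Measurable.ite ?_ measurable_const
      measurable_const).const_mul _
    exact (measurableSet_outcome_eq θ S).preimage (measurable_id.sub_const P)
  measurable_pay i := by
    refine (Finset.measurable_sum _ fun θ _ => Finset.measurable_sum _ fun e _ =>
      Measurable.ite ?_ measurable_const measurable_const).const_mul _
    exact (measurableSet_chosen θ e).preimage (measurable_id.sub_const P)

open Classical in
lemma postedPrices_utility (P : Profile G) (i : B) (v b : Profile G) :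
    (postedPrices P).utility i v b = (Fintype.card (Coins G) : ℝ)⁻¹ *
      ∑ θ : Coins G, ∑ e ∈ Finset.univ.filter (fun e : G => e.1.1 = i),
        if Chosen θ (b - P) e then (v - P) e else 0 := by
  have halloc : ∀ e, (postedPrices P).allocProb b e = (Fintype.card (Coins G) : ℝ)⁻¹ *
      ∑ θ : Coins G, if Chosen θ (b - P) e then 1 else 0 := by
    intro e
    simp only [Mechanism.allocProb, postedPrices]
    rw [← Finset.mul_sum, Finset.sum_comm]
    congr 1
    refine Finset.sum_congr rfl fun θ _ => ?_
    rw [Finset.sum_ite_eq]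
    simp [mem_outcome]
  have hpay : (postedPrices P).pay b i = (Fintype.card (Coins G) : ℝ)⁻¹ *
      ∑ e ∈ Finset.univ.filter (fun e : G => e.1.1 = i), ∑ θ : Coins G,
        if Chosen θ (b - P) e then P e else 0 := by
    rw [Finset.sum_comm]
    rfl
  rw [Mechanism.utility, hpay]
  simp only [halloc, mul_assoc]
  rw [← Finset.mul_sum, ← mul_sub, ← Finset.sum_sub_distrib]
  rw [Finset.sum_comm (s := (Finset.univ : Finset (Coins G)))]
  congr 1
  refine Finset.sum_congr rfl fun e _ => ?_
  rw [Finset.sum_mul, ← Finset.sum_sub_distrib]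
  refine Finset.sum_congr rfl fun θ _ => ?_
  split_ifs <;> simp

theorem postedPrices_truthful (P : Profile G) : (postedPrices P).Truthful := by
  classical
  intro i v b _ _ hvb
  rw [postedPrices_utility, postedPrices_utility]
  refine mul_le_mul_of_nonneg_left (Finset.sum_le_sum fun θ _ => ?_) (by positivity)
  exact sum_chosen_le θ i fun e he => by simp [hvb e he]

theorem postedPrices_individuallyRational (P : Profile G) :
    (postedPrices P).IndividuallyRational := by
  classical
  intro i v _
  rw [postedPrices_utility]
  exact mul_nonneg (by positivity) (Finset.sum_nonneg fun θ _ => sum_chosen_nonneg θ _ i)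

end Posted

/-! ### Averages over the coins -/

section Average

variable {B I : Type*} [Fintype B] [DecidableEq B] [DecidableEq I] {G : Finset (B × I)}

/-- The purchase of `e'` can prevent the one of `e`. -/
def Blocker (o : Bool) (e e' : G) : Prop :=
  (e' ≠ e ∧ e'.1.1 = e.1.1) ∨ (e'.1.2 = e.1.2 ∧ Before o e'.1.1 e.1.1)

lemma Blocker.ne {o : Bool} {e e' : G} (h : Blocker o e e') : e' ≠ e := by
  rcases h with h | h
  · exact h.1
  · rintro rfl
    exact h.2.ne rfl

lemma Blocker.conflict {o : Bool} {e e' : G} (h : Blocker o e e') : Conflict e e' :=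
  ⟨h.ne.symm, h.imp (fun h => h.2.symm) fun h => h.1.symm⟩

lemma card_filter_forall_eq_zero {ι : Type*} [Fintype ι] [DecidableEq ι] (s : Finset ι) :
    (Finset.univ.filter fun ω : ι → Fin 3 => ∀ f ∈ s, ω f = 0).card * 3 ^ s.card =
      3 ^ Fintype.card ι := by
  have h1 : (Finset.univ.filter fun ω : ι → Fin 3 => ∀ f ∈ s, ω f = 0) =
      Fintype.piFinset fun f => if f ∈ s then {0} else Finset.univ := by
    ext ω
    simp only [Finset.mem_filter, Finset.mem_univ, true_and, Fintype.mem_piFinset]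
    refine forall_congr' fun f => ?_
    by_cases hf : f ∈ s <;> simp [hf]
  have h2 : 3 ^ s.card = ∏ f : ι, if f ∈ s then 3 else 1 := by
    rw [Finset.prod_ite_mem, Finset.univ_inter, Finset.prod_const]
  rw [h1, Fintype.card_piFinset, h2, ← Finset.prod_mul_distrib, ← Finset.card_univ,
    ← Finset.prod_const]
  refine Finset.prod_congr rfl fun f _ => ?_
  by_cases hf : f ∈ s <;> simp [hf]

open Classical in
lemma sum_coins_eq (s : Finset G) (p : Bool → Prop) :
    (∑ θ : Coins G, if (∀ f ∈ s, θ.1 f = 0) ∧ p θ.2 then (1 : ℝ) else 0) * 3 ^ s.card =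
      (∑ o : Bool, if p o then 1 else 0) * (Fintype.card (Coins G) / 2) := by
  have h := congrArg (Nat.cast : ℕ → ℝ) (card_filter_forall_eq_zero s)
  push_cast at h
  have hW : (Fintype.card (Coins G) : ℝ) / 2 = 3 ^ Fintype.card G := by
    simp [Fintype.card_prod]
  rw [hW, ← h, Fintype.sum_prod_type]
  have h2 : ∀ ω : G → Fin 3, (∑ o : Bool, if (∀ f ∈ s, ω f = 0) ∧ p o then (1 : ℝ) else 0) =
      (if ∀ f ∈ s, ω f = 0 then 1 else 0) * ∑ o : Bool, if p o then 1 else 0 := by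
    intro ω
    by_cases hω : ∀ f ∈ s, ω f = 0
    · simp only [eq_true hω, true_and, if_true, one_mul]
    · simp only [eq_false hω, false_and, if_false, Finset.sum_const_zero, zero_mul]
  simp only [h2]
  rw [← Finset.sum_mul, Finset.sum_boole]
  ring

open Classical in
lemma sum_coins_on_sale (e : G) :
    (∑ θ : Coins G, if θ.1 e = 0 then (1 : ℝ) else 0) = Fintype.card (Coins G) / 3 := by
  have h := sum_coins_eq {e} fun _ => True
  simp only [Finset.mem_singleton, forall_eq, and_true, Finset.card_singleton, if_true,
    Finset.sum_const, Finset.card_univ, Fintype.card_bool, nsmul_eq_mul] at h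
  push_cast at h
  linarith

-- Both edges are on sale with probability 1/9. A rival edge of the same buyer can block in both
-- arrival orders; one that shares only the item blocks in exactly one of them, which gives 1/18.
open Classical in
lemma sum_coins_blocker_le (e e' : G) :
    (∑ θ : Coins G, if θ.1 e = 0 ∧ Blocker θ.2 e e' ∧ θ.1 e' = 0 then (1 : ℝ) else 0) ≤
      Fintype.card (Coins G) * ((if e'.1.1 = e.1.1 then 1 / 9 else 0) +
        if e'.1.2 = e.1.2 then 1 / 18 else 0) := by
  have hW : (0 : ℝ) ≤ Fintype.card (Coins G) := Nat.cast_nonneg _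
  have hr : (0 : ℝ) ≤ Fintype.card (Coins G) * ((if e'.1.1 = e.1.1 then 1 / 9 else 0) +
        if e'.1.2 = e.1.2 then 1 / 18 else 0) := by
    refine mul_nonneg hW (add_nonneg ?_ ?_) <;> split_ifs <;> norm_num
  by_cases hne : e' = e
  · rw [Finset.sum_eq_zero fun θ _ => if_neg fun h => h.2.1.ne hne]
    exact hr
  have h := sum_coins_eq {e, e'} fun o => Blocker o e e'
  have hset : ∀ θ : Coins G, ((∀ f ∈ ({e, e'} : Finset G), θ.1 f = 0) ∧ Blocker θ.2 e e') ↔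
      (θ.1 e = 0 ∧ Blocker θ.2 e e' ∧ θ.1 e' = 0) := by
    intro θ
    simp only [Finset.mem_insert, Finset.mem_singleton, forall_eq_or_imp, forall_eq]
    tauto
  simp only [hset] at h
  rw [Finset.card_pair (Ne.symm hne)] at h
  by_cases hb : e'.1.1 = e.1.1
  · have h1 : (∑ o : Bool, if Blocker o e e' then (1 : ℝ) else 0) ≤ 2 := by
      rw [Fintype.sum_bool]
      split_ifs <;> norm_num
    have h2 := mul_le_mul_of_nonneg_right h1 (by positivity : (0:ℝ) ≤ Fintype.card (Coins G) / 2)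
    rw [if_pos hb]
    have h3 : (0 : ℝ) ≤ if e'.1.2 = e.1.2 then 1 / 18 else 0 := by split_ifs <;> norm_num
    have := mul_nonneg hW h3
    rw [mul_add]
    linarith
  · have hbl : ∀ o, Blocker o e e' ↔ e'.1.2 = e.1.2 ∧ Before o e'.1.1 e.1.1 := fun o => by
      simp [Blocker, hb]
    by_cases hi : e'.1.2 = e.1.2
    · have h1 : (∑ o : Bool, if Blocker o e e' then (1 : ℝ) else 0) ≤ 1 := by
        rw [Fintype.sum_bool]
        simp only [hbl, hi, true_and]
        split_ifs with ha hb
        · exact (before_true_false ha hb).elim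
        all_goals norm_num
      have h2 := mul_le_mul_of_nonneg_right h1
        (by positivity : (0:ℝ) ≤ Fintype.card (Coins G) / 2)
      rw [if_neg hb, if_pos hi]
      linarith
    · rw [Finset.sum_eq_zero fun θ _ => if_neg fun h => hi ((hbl _).1 h.2.1).1]
      exact hr

open Classical in
/-- If the edge `e` is available with the probability that the union bound gives, then it is
on sale and available with probability at least `1 / 6`. -/
lemma one_sixth_le_average (e : G) {q : G → ℝ} (hq : ∀ f, 0 ≤ q f) {h : Coins G → ℝ}
    (hh : ∀ θ, 1 ≤ h θ + ∑ e' : G, if Blocker θ.2 e e' ∧ θ.1 e' = 0 then q e' else 0)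
    (hB : ∑ e' ∈ Finset.univ.filter (fun e' : G => e'.1.1 = e.1.1), q e' ≤ 1)
    (hI : ∑ e' ∈ Finset.univ.filter (fun e' : G => e'.1.2 = e.1.2), q e' ≤ 1) :
    1 / 6 ≤ (Fintype.card (Coins G) : ℝ)⁻¹ * ∑ θ : Coins G, if θ.1 e = 0 then h θ else 0 := by
  have hW : (0 : ℝ) < Fintype.card (Coins G) := Nat.cast_pos.2 Fintype.card_pos
  have h1 : (∑ θ : Coins G, if θ.1 e = 0 then (1 : ℝ) else 0) ≤
      (∑ θ : Coins G, if θ.1 e = 0 then h θ else 0) + ∑ e' : G, q e' * ∑ θ : Coins G,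
        if θ.1 e = 0 ∧ Blocker θ.2 e e' ∧ θ.1 e' = 0 then (1 : ℝ) else 0 := by
    simp only [Finset.mul_sum]
    rw [Finset.sum_comm, ← Finset.sum_add_distrib]
    refine Finset.sum_le_sum fun θ _ => ?_
    by_cases hθ : θ.1 e = 0
    · simpa [hθ] using hh θ
    · simp [hθ]
  have h2 : ∑ e' : G, q e' * (∑ θ : Coins G,
        if θ.1 e = 0 ∧ Blocker θ.2 e e' ∧ θ.1 e' = 0 then (1 : ℝ) else 0) ≤
      Fintype.card (Coins G) * (1 / 9 * ∑ e' ∈ Finset.univ.filter (fun e' : G => e'.1.1 = e.1.1),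
        q e' + 1 / 18 * ∑ e' ∈ Finset.univ.filter (fun e' : G => e'.1.2 = e.1.2), q e') := by
    rw [Finset.sum_filter, Finset.sum_filter, Finset.mul_sum, Finset.mul_sum,
      ← Finset.sum_add_distrib, Finset.mul_sum]
    refine Finset.sum_le_sum fun e' _ => ?_
    refine (mul_le_mul_of_nonneg_left (sum_coins_blocker_le e e') (hq e')).trans (le_of_eq ?_)
    split_ifs <;> ring
  rw [sum_coins_on_sale] at h1
  rw [le_inv_mul_iff₀ hW]
  -- Of the probability 1/3 of being on sale, at most 1/9 + 1/18 = 1/6 is lost to blocking.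
  have h3 : 1 / 9 * ∑ e' ∈ Finset.univ.filter (fun e' : G => e'.1.1 = e.1.1),
        q e' + 1 / 18 * ∑ e' ∈ Finset.univ.filter (fun e' : G => e'.1.2 = e.1.2), q e' ≤ 1 / 6 := by
    linarith
  have h4 := mul_le_mul_of_nonneg_left h3 hW.le
  linarith

end Average

/-! ### Auctions from threshold rules -/

section Auction

variable {B I : Type*} [Fintype B] [DecidableEq B] [DecidableEq I] {G : Finset (B × I)}

/-- A rule that assigns to every edge a threshold which does not depend on its own value, such
that the edges with values above their thresholds form a matching. -/
structure IsThreshold (T : G → Profile G → ℝ) : Prop where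
  measurable : ∀ e, Measurable (T e)
  nonneg : ∀ e v, 0 ≤ T e v
  update : ∀ e v x, T e (Function.update v e x) = T e v
  packing : ∀ v : Profile G, (∀ f, 0 ≤ v f) → ∀ e e', Conflict e e' → T e v < v e → ¬ T e' v < v e'

variable {T : G → Profile G → ℝ} {N : ℕ}

/-- The price of an edge `e` is the larger one of its threshold in the sample `c e` and of its
value in the sample `l`. -/
def samplePrices (T : G → Profile G → ℝ) (c : G → Fin N) (l : Fin N) (s : Fin N → Profile G) :
    Profile G :=
  fun e => max (T e (s (c e))) (s l e)

lemma IsThreshold.measurable_samplePrices (hT : IsThreshold T) (c : G → Fin N) (l : Fin N) :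
    Measurable (samplePrices T c l) :=
  measurable_pi_iff.2 fun e => ((hT.measurable e).comp (measurable_pi_apply (c e))).max
    ((measurable_pi_apply e).comp (measurable_pi_apply l))

lemma IsThreshold.measurable_sub_samplePrices (hT : IsThreshold T) (c : G → Fin N) (l : Fin N) :
    Measurable fun p : (Fin N → Profile G) × Profile G => p.2 - samplePrices T c l p.1 :=
  measurable_snd.sub ((hT.measurable_samplePrices c l).comp measurable_fst)

/-- Posted prices from a threshold rule and samples. -/
def thresholdAuction (hT : IsThreshold T) (c : G → Fin N) (l : Fin N) : SampleAuction G N where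
  mech s := postedPrices (samplePrices T c l s)
  measurable_lottery S := by
    refine (Finset.measurable_sum _ fun θ _ => Measurable.ite ?_ measurable_const
      measurable_const).const_mul _
    exact (measurableSet_outcome_eq θ S).preimage (hT.measurable_sub_samplePrices c l)
  measurable_pay i := by
    refine (Finset.measurable_sum _ fun θ _ => Finset.measurable_sum _ fun e _ =>
      Measurable.ite ?_ ?_ measurable_const).const_mul _
    · exact (measurableSet_chosen θ e).preimage (hT.measurable_sub_samplePrices c l)
    · exact ((measurable_pi_apply e).comp (hT.measurable_samplePrices c l)).comp measurable_fst

lemma IsThreshold.samplePrices_nonneg (hT : IsThreshold T) (c : G → Fin N) (l : Fin N)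
    (s : Fin N → Profile G) (e : G) : 0 ≤ samplePrices T c l s e :=
  (hT.nonneg _ _).trans (le_max_left _ _)

open Classical in
lemma sum_pay_eq (P b : Profile G) :
    ∑ i, (postedPrices P).pay b i = (Fintype.card (Coins G) : ℝ)⁻¹ *
      ∑ θ : Coins G, ∑ e : G, if Chosen θ (b - P) e then P e else 0 := by
  simp only [postedPrices]
  rw [← Finset.mul_sum, Finset.sum_comm]
  congr 1
  refine Finset.sum_congr rfl fun θ _ => ?_
  exact Finset.sum_fiberwise Finset.univ (fun e : G => e.1.1) _

lemma ae_pi_nonneg (D : G → Measure ℝ) [∀ e, IsProbabilityMeasure (D e)]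
    (hD : ∀ e, D e (Iio 0) = 0) : ∀ᵐ v ∂Measure.pi D, ∀ f, 0 ≤ v f := by
  refine ae_all_iff.2 fun f => ?_
  refine (Measure.quasiMeasurePreserving_eval D f).ae (p := fun x => 0 ≤ x) ?_
  rw [ae_iff, show {a : ℝ | ¬ 0 ≤ a} = Iio 0 by ext; simp, hD f]

lemma expectation_of_nonneg {Ω : Type*} [MeasurableSpace Ω] (P : Measure Ω) {f : Ω → ℝ}
    (hf : ∀ ω, 0 ≤ f ω) :
    expectation P f = ((∫⁻ ω, ENNReal.ofReal (f ω) ∂P : ENNReal) : EReal) := by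
  have : ∀ ω, ENNReal.ofReal (-(f ω)) = 0 := fun ω =>
    ENNReal.ofReal_eq_zero.2 (neg_nonpos.2 (hf ω))
  simp [expectation, this]

lemma expectation_le {Ω : Type*} [MeasurableSpace Ω] (P : Measure Ω) (f : Ω → ℝ) :
    expectation P f ≤ ((∫⁻ ω, ENNReal.ofReal (f ω) ∂P : ENNReal) : EReal) := by
  unfold expectation
  exact (EReal.sub_le_sub le_rfl (EReal.coe_ennreal_nonneg _)).trans (by simp)

variable (D : G → Measure ℝ) [∀ e, IsProbabilityMeasure (D e)]

/-- The probability that the value of `e` is above its threshold is not changed if the threshold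
is computed from a sample. -/
lemma measureReal_threshold_le [∀ e, NullSingletonClass (D e)] (hT : IsThreshold T) (k : Fin N)
    (e : G) :
    (sampleLaw D N).real {p | T e (p.1 k) ≤ p.2 e} ≤ (Measure.pi D).real {v | T e v < v e} := by
  have hm1 : MeasurableSet {q : Profile G × ℝ | T e q.1 ≤ q.2} :=
    measurableSet_le ((hT.measurable e).comp measurable_fst) measurable_snd
  have hm2 : MeasurableSet {q : Profile G × ℝ | T e q.1 < q.2} :=
    measurableSet_lt ((hT.measurable e).comp measurable_fst) measurable_snd
  have hm3 : MeasurableSet {v : Profile G | T e v < v e} :=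
    measurableSet_lt (hT.measurable e) (measurable_pi_apply e)
  have h1 : MeasurePreserving (fun p : (Fin N → Profile G) × Profile G => (p.1 k, p.2 e))
      (sampleLaw D N) ((Measure.pi D).prod (D e)) :=
    (measurePreserving_eval (fun _ : Fin N => Measure.pi D) k).prod (measurePreserving_eval D e)
  have e1 : (sampleLaw D N) {p | T e (p.1 k) ≤ p.2 e} =
      ((Measure.pi D).prod (D e)) {q | T e q.1 ≤ q.2} :=
    h1.measure_preimage hm1.nullMeasurableSet
  have e2 : (Measure.pi D) {v | T e v < v e} =
      ((Measure.pi D).prod (D e)) {q | T e q.1 < q.2} := by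
    rw [← (measurePreserving_update D e).measure_preimage hm3.nullMeasurableSet]
    congr 1
    ext q
    simp [hT.update]
  rw [Measure.real, Measure.real, e1, e2, Measure.prod_apply hm1, Measure.prod_apply hm2]
  refine le_of_eq (congrArg _ (lintegral_congr fun v => ?_))
  -- Packing uses strict excess, while buyers accept at equality; without atoms the two
  -- probabilities agree.
  exact (measure_congr (Ioi_ae_eq_Ici (a := T e v) (μ := D e))).symm

/-- By packing, these events are disjoint up to a null set when the edges conflict pairwise, as at
one buyer or one item. -/
lemma sum_measureReal_threshold_le (hD : ∀ e, D e (Iio 0) = 0) (hT : IsThreshold T)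
    (K : Finset G) (hK : ∀ e ∈ K, ∀ e' ∈ K, e ≠ e' → Conflict e e') :
    ∑ e ∈ K, (Measure.pi D).real {v | T e v < v e} ≤ 1 := by
  have hnn := ae_pi_nonneg D hD
  have hm : ∀ e, MeasurableSet {v : Profile G | T e v < v e} := fun e =>
    measurableSet_lt (hT.measurable e) (measurable_pi_apply e)
  have hd : (K : Set G).Pairwise
      (Function.onFun (AEDisjoint (Measure.pi D)) fun e => {v | T e v < v e}) := by
    intro e he e' he' hne
    refine measure_mono_null (t := {v | ¬ ∀ f, 0 ≤ v f}) ?_ hnn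
    intro v hv hvn
    exact hT.packing v hvn e e' (hK e he e' he' hne) hv.1 hv.2
  rw [← measureReal_biUnion_finset₀ hd fun e _ => (hm e).nullMeasurableSet]
  exact measureReal_le_one

open Classical in
/-- The expected revenue of the auction, in terms of the revenue from single buyers. -/
theorem lintegral_pay_ge [∀ e, NullSingletonClass (D e)] (hD : ∀ e, D e (Iio 0) = 0)
    (hT : IsThreshold T) {c : G → Fin N} {l : Fin N} (hcl : ∀ e, c e ≠ l)
    (hc : ∀ e e', Conflict e e' → c e ≠ c e') :
    ENNReal.ofReal (1 / 6) * ∑ e, ∫⁻ v, sampleRevenue (D e) (T e v) ∂Measure.pi D ≤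
      ∫⁻ p, ENNReal.ofReal (∑ i, ((thresholdAuction hT c l).mech p.1).pay p.2 i)
        ∂sampleLaw D N := by
  set P := samplePrices T c l with hP
  have hPm : ∀ e, Measurable fun p : (Fin N → Profile G) × Profile G => P p.1 e := fun e =>
    ((measurable_pi_apply e).comp (hT.measurable_samplePrices c l)).comp measurable_fst
  set F : G → (Fin N → Profile G) × Profile G → ENNReal := fun e p =>
    if P p.1 e ≤ p.2 e then ENNReal.ofReal (P p.1 e) else 0 with hF
  have hFm : ∀ e, Measurable (F e) := fun e =>
    Measurable.ite (measurableSet_le (hPm e) ((measurable_pi_apply e).comp measurable_snd))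
      (hPm e).ennreal_ofReal measurable_const
  -- The event that nothing blocks `e`; with `F e`, the revenue from `e` at its price if it is
  -- available, it bounds the payments from below.
  set A : Coins G → G → Set ((Fin N → Profile G) × Profile G) := fun θ e =>
    {p | ∀ e', Blocker θ.2 e e' → ¬ Wants θ (p.2 - P p.1) e'} with hA
  have hAm : ∀ θ e, MeasurableSet (A θ e) := fun θ e => by
    refine measurableSet_setOfPred.2 (Measurable.forall fun e' => measurable_const.imp ?_)
    exact ((measurable_wants θ e').comp (hT.measurable_sub_samplePrices c l)).not
  -- independence
  have hind : ∀ θ e, ∫⁻ p, F e p * (A θ e).indicator 1 p ∂sampleLaw D N =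
      (∫⁻ p, F e p ∂sampleLaw D N) * sampleLaw D N (A θ e) := by
    intro θ e
    -- `F e` reads all of sample `c e`, but only the coordinate `e` of sample `l` and of the values.
    -- A blocker `e'` conflicts with `e`, so it reads another sample `c e'` and the other
    -- coordinates `e'`.
    rw [lintegral_mul_of_disjoint_coord D
      {x | (∃ f, x = (some (c e), f)) ∨ x = (some l, e) ∨ x = (none, e)} (hFm e)
      (measurable_one.indicator (hAm θ e)), lintegral_indicator_one (hAm θ e)]
    · intro p q hpq
      have h1 : p.1 (c e) = q.1 (c e) := funext fun f => hpq (some (c e), f) (Or.inl ⟨f, rfl⟩)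
      have h2 : p.1 l e = q.1 l e := hpq (some l, e) (Or.inr (Or.inl rfl))
      have h3 : p.2 e = q.2 e := hpq (none, e) (Or.inr (Or.inr rfl))
      simp only [hF, hP, samplePrices, h1, h2, h3]
    · intro p q hpq
      have key : ∀ e', Blocker θ.2 e e' → (p.2 - P p.1) e' = (q.2 - P q.1) e' := by
        intro e' he'
        have h1 : p.1 (c e') = q.1 (c e') := funext fun f => hpq (some (c e'), f) (by
          simp only [Set.mem_ofPred_eq, Prod.mk.injEq, Option.some.injEq, reduceCtorEq, false_and,
            or_false, not_or, not_exists, not_and]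
          exact ⟨fun _ h => absurd h.symm (hc e e' he'.conflict), fun h => absurd h (hcl e')⟩)
        have h2 : p.1 l e' = q.1 l e' := hpq (some l, e') (by
          simp only [Set.mem_ofPred_eq, Prod.mk.injEq, Option.some.injEq, reduceCtorEq, false_and,
            or_false, not_or, not_exists, not_and]
          exact ⟨fun _ h => absurd h.symm (hcl e), fun _ => he'.ne⟩)
        have h3 : p.2 e' = q.2 e' := hpq (none, e') (by simp [he'.ne])
        simp only [Pi.sub_apply, hP, samplePrices, h1, h2, h3]
      have : p ∈ A θ e ↔ q ∈ A θ e := by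
        refine forall_congr' fun e' => imp_congr_right fun he' => ?_
        rw [Wants, Wants, key e' he']
      by_cases hp : p ∈ A θ e
      · rw [indicator_of_mem hp, indicator_of_mem (this.1 hp)]
        rfl
      · rw [indicator_of_notMem hp, indicator_of_notMem fun h => hp (this.2 h)]
  -- the revenue from one edge
  have hFZ : ∀ e, ∫⁻ p, F e p ∂sampleLaw D N =
      ∫⁻ v, sampleRevenue (D e) (T e v) ∂Measure.pi D := by
    intro e
    have hm : Measurable fun q : (Profile G × ℝ) × ℝ =>
        if max (T e q.1.1) q.1.2 ≤ q.2 then ENNReal.ofReal (max (T e q.1.1) q.1.2) else 0 := by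
      have hm' : Measurable fun q : (Profile G × ℝ) × ℝ => max (T e q.1.1) q.1.2 :=
        ((hT.measurable e).comp (measurable_fst.comp measurable_fst)).max (by fun_prop)
      exact Measurable.ite (measurableSet_le hm' measurable_snd) hm'.ennreal_ofReal
        measurable_const
    have h1 := (measurePreserving_sample_pair D (hcl e) e).lintegral_comp hm
    refine Eq.trans h1 ?_
    rw [lintegral_prod _ hm.aemeasurable, lintegral_prod _ hm.lintegral_prod_right'.aemeasurable]
    refine lintegral_congr fun v => lintegral_congr fun r => ?_
    have h2 : ∀ x : ℝ, (if max (T e v) r ≤ x then ENNReal.ofReal (max (T e v) r) else 0) =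
        (Ici (max (T e v) r)).indicator (fun _ => ENNReal.ofReal (max (T e v) r)) x := fun x => by
      simp [indicator_apply]
    simp only [h2]
    rw [lintegral_indicator measurableSet_Ici, setLIntegral_const, ← ofReal_survival,
      ← ENNReal.ofReal_mul ((hT.nonneg e v).trans (le_max_left _ _))]
  -- the probability that an edge is available
  set q : G → ℝ := fun e => (Measure.pi D).real {v | T e v < v e} with hq
  have hh : ∀ e θ, 1 ≤ (sampleLaw D N).real (A θ e) +
      ∑ e' : G, if Blocker θ.2 e e' ∧ θ.1 e' = 0 then q e' else 0 := by
    intro e θ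
    -- A wanted blocker has a value above its price, hence above its sampled threshold; the reserve
    -- only makes this rarer.
    have hsub : (univ : Set ((Fin N → Profile G) × Profile G)) ⊆ A θ e ∪
        ⋃ e' ∈ Finset.univ.filter (fun e' => Blocker θ.2 e e' ∧ θ.1 e' = 0),
          {p | T e' (p.1 (c e')) ≤ p.2 e'} := by
      intro p _
      by_cases hp : p ∈ A θ e
      · exact Or.inl hp
      · right
        simp only [hA, Set.mem_ofPred_eq, not_forall, not_not] at hp
        obtain ⟨e', hb, hw⟩ := hp
        simp only [mem_iUnion]
        refine ⟨e', by simp [hb, hw.1], ?_⟩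
        have := hw.2
        rw [Pi.sub_apply, sub_nonneg] at this
        exact (le_max_left _ _).trans this
    calc (1 : ℝ) = (sampleLaw D N).real univ := probReal_univ.symm
      _ ≤ _ := measureReal_mono hsub
      _ ≤ _ := measureReal_union_le _ _
      _ ≤ _ := add_le_add le_rfl (measureReal_biUnion_finset_le _ _)
      _ ≤ _ := by
        rw [← Finset.sum_filter]
        exact add_le_add le_rfl (Finset.sum_le_sum fun e' _ =>
          measureReal_threshold_le D hT (c e') e')
  have hav : ∀ e, 1 / 6 ≤ (Fintype.card (Coins G) : ℝ)⁻¹ *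
      ∑ θ : Coins G, if θ.1 e = 0 then (sampleLaw D N).real (A θ e) else 0 := by
    intro e
    refine one_sixth_le_average e (fun f => measureReal_nonneg) (hh e) ?_ ?_
    · refine sum_measureReal_threshold_le D hD hT _ fun f hf f' hf' hne => ⟨hne, Or.inl ?_⟩
      rw [(Finset.mem_filter.1 hf).2, (Finset.mem_filter.1 hf').2]
    · refine sum_measureReal_threshold_le D hD hT _ fun f hf f' hf' hne => ⟨hne, Or.inr ?_⟩
      rw [(Finset.mem_filter.1 hf).2, (Finset.mem_filter.1 hf').2]
  -- the pointwise bound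
  have hpt : ∀ p : (Fin N → Profile G) × Profile G,
      ∑ e : G, ∑ θ : Coins G, ENNReal.ofReal (Fintype.card (Coins G) : ℝ)⁻¹ *
        (if θ.1 e = 0 then F e p * (A θ e).indicator 1 p else 0) ≤
      ENNReal.ofReal (∑ i, ((thresholdAuction hT c l).mech p.1).pay p.2 i) := by
    intro p
    have hPn := hT.samplePrices_nonneg c l p.1
    rw [show (thresholdAuction hT c l).mech p.1 = postedPrices (P p.1) from rfl, sum_pay_eq,
      ENNReal.ofReal_mul (by positivity), ENNReal.ofReal_sum_of_nonneg
        (fun θ _ => Finset.sum_nonneg fun e _ => by split_ifs; exacts [hPn e, le_rfl]),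
      Finset.sum_comm, Finset.mul_sum]
    refine Finset.sum_le_sum fun θ _ => ?_
    rw [ENNReal.ofReal_sum_of_nonneg (fun e _ => by split_ifs; exacts [hPn e, le_rfl]),
      Finset.mul_sum]
    refine Finset.sum_le_sum fun e _ => mul_le_mul_right ?_ _
    by_cases hθ : θ.1 e = 0
    swap
    · rw [if_neg hθ]; exact zero_le
    rw [if_pos hθ]
    by_cases hp : p ∈ A θ e
    swap
    · rw [indicator_of_notMem hp, mul_zero]; exact zero_le
    by_cases hv : P p.1 e ≤ p.2 e
    swap
    · simp only [hF, if_neg hv, zero_mul]; exact zero_le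
    have hch : Chosen θ (p.2 - P p.1) e := by
      refine chosen_of_wants ⟨hθ, by simpa using hv⟩ (fun e' hne hb => ?_) fun e' hi hb => ?_
      · exact hp e' (Or.inl ⟨hne, hb⟩)
      · exact hp e' (Or.inr ⟨hi, hb⟩)
    rw [if_pos hch, indicator_of_mem hp, Pi.one_apply, mul_one]
    simp only [hF, if_pos hv, le_refl]
  refine le_trans ?_ (lintegral_mono hpt)
  have hFA : ∀ e θ, Measurable fun p => F e p * (A θ e).indicator 1 p := fun e θ =>
    (hFm e).mul (measurable_one.indicator (hAm θ e))
  have hterm : ∀ e θ, Measurable fun p => ENNReal.ofReal (Fintype.card (Coins G) : ℝ)⁻¹ *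
      (if θ.1 e = 0 then F e p * (A θ e).indicator 1 p else 0) := by
    intro e θ
    refine Measurable.const_mul ?_ _
    by_cases hθ : θ.1 e = 0
    · simp only [if_pos hθ]
      exact hFA e θ
    · simp only [if_neg hθ, measurable_const]
  rw [lintegral_finsetSum _ fun e _ => Finset.measurable_sum _ fun θ _ => hterm e θ,
    Finset.mul_sum]
  refine Finset.sum_le_sum fun e _ => ?_
  rw [lintegral_finsetSum _ fun θ _ => hterm e θ, ← hFZ e]
  have hθ : ∀ θ, ∫⁻ p, ENNReal.ofReal (Fintype.card (Coins G) : ℝ)⁻¹ *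
      (if θ.1 e = 0 then F e p * (A θ e).indicator 1 p else 0) ∂sampleLaw D N =
      (∫⁻ p, F e p ∂sampleLaw D N) * ENNReal.ofReal ((Fintype.card (Coins G) : ℝ)⁻¹ *
        if θ.1 e = 0 then (sampleLaw D N).real (A θ e) else 0) := by
    intro θ
    by_cases hθ : θ.1 e = 0
    · simp only [if_pos hθ]
      rw [lintegral_const_mul _ (hFA e θ), hind,
        ENNReal.ofReal_mul (by positivity), ofReal_measureReal]
      ring
    · simp [if_neg hθ]
  simp only [hθ]
  rw [← Finset.mul_sum, ← ENNReal.ofReal_sum_of_nonneg (fun θ _ => mul_nonneg (by positivity)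
    (by split_ifs; exacts [measureReal_nonneg, le_rfl])), ← Finset.mul_sum, mul_comm]
  exact mul_le_mul_right (ENNReal.ofReal_le_ofReal (hav e)) _

end Auction

/-! ### Colourings of the edges -/

/-- Greedy colouring: a new vertex avoids the current colours of all its neighbours, of which there
are fewer than n; vertices outside S carry arbitrary colours. -/
lemma exists_proper_coloring {V : Type*} [Fintype V] [DecidableEq V] (r : V → V → Prop)
    [DecidableRel r] (hr : ∀ v w, r v w → r w v) (hi : ∀ v, ¬ r v v) {n : ℕ}
    (hn : ∀ v, (Finset.univ.filter (r v)).card < n) :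
    ∃ c : V → Fin n, ∀ v w, r v w → c v ≠ c w := by
  rcases isEmpty_or_nonempty V with hV | ⟨⟨v₀⟩⟩
  · exact ⟨fun v => hV.elim v, fun v => hV.elim v⟩
  have hn0 : 0 < n := (Nat.zero_le _).trans_lt (hn v₀)
  suffices h : ∀ S : Finset V, ∃ c : V → Fin n, ∀ v ∈ S, ∀ w ∈ S, r v w → c v ≠ c w by
    obtain ⟨c, hc⟩ := h Finset.univ
    exact ⟨c, fun v w => hc v (Finset.mem_univ v) w (Finset.mem_univ w)⟩
  intro S
  induction S using Finset.induction_on with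
  | empty => exact ⟨fun _ => ⟨0, hn0⟩, by simp⟩
  | insert a S ha ih =>
    obtain ⟨c, hc⟩ := ih
    obtain ⟨x, hx⟩ : ∃ x : Fin n, x ∉ (Finset.univ.filter (r a)).image c := by
      by_contra! hall
      have h1 : (Finset.univ : Finset (Fin n)).card ≤ ((Finset.univ.filter (r a)).image c).card :=
        Finset.card_le_card fun x _ => hall x
      have := (h1.trans Finset.card_image_le).trans_lt (hn a)
      simp at this
    have hx' : ∀ w, r a w → x ≠ c w := fun w hw h =>
      hx (Finset.mem_image.2 ⟨w, by simp [hw], h.symm⟩)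
    refine ⟨Function.update c a x, fun v hv w hw hvw => ?_⟩
    rcases Finset.mem_insert.1 hv with rfl | hv
    · have hne : w ≠ v := fun h => hi v (h ▸ hvw)
      rw [Function.update_self, Function.update_of_ne hne]
      exact hx' w hvw
    · have hva : v ≠ a := fun h => ha (h ▸ hv)
      rw [Function.update_of_ne hva]
      rcases Finset.mem_insert.1 hw with rfl | hw
      · rw [Function.update_self]
        exact (hx' v (hr _ _ hvw)).symm
      · have hwa : w ≠ a := fun h => ha (h ▸ hw)
        rw [Function.update_of_ne hwa]
        exact hc v hv w hw hvw

section Thresholds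

variable {B I : Type*} [DecidableEq B] [DecidableEq I] {G : Finset (B × I)}

lemma Conflict.symm {e e' : G} (h : Conflict e e') : Conflict e' e :=
  ⟨h.1.symm, h.2.imp Eq.symm Eq.symm⟩

/-- Conflicting edges get different samples from the first `d ^ 2` ones. -/
lemma DegreeAtMost.exists_coloring {d : ℕ} (hG : DegreeAtMost G d) :
    ∃ c : G → Fin (d ^ 2 + 1), (∀ e, c e ≠ Fin.last _) ∧ ∀ e e', Conflict e e' → c e ≠ c e' := by
  classical
  have hdeg : ∀ e : G, (Finset.univ.filter (Conflict e)).card < d ^ 2 := by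
    intro e
    have h1 : Finset.univ.filter (Conflict e) ⊆
        (Finset.univ.filter fun e' : G => e'.1.1 = e.1.1).erase e ∪
        (Finset.univ.filter fun e' : G => e'.1.2 = e.1.2).erase e := by
      intro e' he'
      have h := (Finset.mem_filter.1 he').2
      rcases h.2 with h2 | h2
      · exact Finset.mem_union_left _ (by simp [h.1.symm, h2])
      · exact Finset.mem_union_right _ (by simp [h.1.symm, h2])
    have hb : (Finset.univ.filter fun e' : G => e'.1.1 = e.1.1).card ≤ d :=
      (Finset.card_le_card_of_injOn Subtype.val (fun e' he' => by
        simpa using he') (Subtype.val_injective.injOn)).trans (hG.1 e.1.1)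
    have hi : (Finset.univ.filter fun e' : G => e'.1.2 = e.1.2).card ≤ d :=
      (Finset.card_le_card_of_injOn Subtype.val (fun e' he' => by
        simpa using he') (Subtype.val_injective.injOn)).trans (hG.2 e.1.2)
    have h2 := (Finset.card_le_card h1).trans (Finset.card_union_le _ _)
    rw [Finset.card_erase_of_mem (by simp), Finset.card_erase_of_mem (by simp)] at h2
    have hpos : 0 < (Finset.univ.filter fun e' : G => e'.1.1 = e.1.1).card :=
      Finset.card_pos.2 ⟨e, by simp⟩
    -- An edge exists, so d ≥ 1. It has at most 2(d - 1) conflicts, fewer than d² since 2k < (k +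
    -- 1)².
    obtain ⟨k, rfl⟩ : ∃ k, d = k + 1 := ⟨d - 1, by omega⟩
    have : 2 * k < (k + 1) ^ 2 := by nlinarith
    omega
  obtain ⟨c, hc⟩ := exists_proper_coloring Conflict (fun _ _ h => h.symm) (fun e h => h.1 rfl) hdeg
  -- The last sample is left uncoloured and supplies the reserves.
  exact ⟨fun e => (c e).castSucc, fun e => (Fin.castSucc_lt_last _).ne, fun e e' h =>
    (Fin.castSucc_injective _).ne (hc e e' h)⟩

/-! ### Thresholds from maximum weight matchings -/

lemma IsMatching.subset {S S' : Finset G} (h : IsMatching S) (hs : S' ⊆ S) : IsMatching S' :=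
  fun e he e' he' => h e (hs he) e' (hs he')

lemma isMatching_empty : IsMatching (∅ : Finset G) := by simp [IsMatching]

lemma isMatching_singleton (e : G) : IsMatching ({e} : Finset G) := by
  intro a ha b hb hne
  rw [Finset.mem_singleton] at ha hb
  exact absurd (ha.trans hb.symm) hne

lemma IsMatching.not_conflict {S : Finset G} (h : IsMatching S) {e e' : G} (he : e ∈ S)
    (he' : e' ∈ S) : ¬ Conflict e e' := fun hc =>
  hc.2.elim (h e he e' he' hc.1).1 (h e he e' he' hc.1).2

open Classical in
/-- The largest weight that the other edges of a matching with the edge `e` can have. -/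
def weightWith (e : G) (v : Profile G) : ℝ :=
  (Finset.univ.filter fun S : Finset G => IsMatching S ∧ e ∈ S).sup'
    ⟨{e}, by simp [isMatching_singleton]⟩ fun S => ∑ f ∈ S.erase e, v f

open Classical in
/-- The largest weight of a matching without the edge `e`. -/
def weightWithout (e : G) (v : Profile G) : ℝ :=
  (Finset.univ.filter fun S : Finset G => IsMatching S ∧ e ∉ S).sup'
    ⟨∅, by simp [isMatching_empty]⟩ fun S => ∑ f ∈ S, v f

/-- The value from which on `e` belongs to a maximum weight matching. -/
def matchingThreshold (e : G) (v : Profile G) : ℝ := weightWithout e v - weightWith e v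

lemma sum_erase_le_weightWith {e : G} {S : Finset G} (hS : IsMatching S) (he : e ∈ S)
    (v : Profile G) : ∑ f ∈ S.erase e, v f ≤ weightWith e v := by
  classical
  unfold weightWith
  exact Finset.le_sup' (fun S : Finset G => ∑ f ∈ S.erase e, v f) (by simp [hS, he])

lemma sum_le_weightWithout {e : G} {S : Finset G} (hS : IsMatching S) (he : e ∉ S)
    (v : Profile G) : ∑ f ∈ S, v f ≤ weightWithout e v := by
  classical
  unfold weightWithout
  exact Finset.le_sup' (fun S : Finset G => ∑ f ∈ S, v f) (by simp [hS, he])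

lemma exists_weightWith (e : G) (v : Profile G) :
    ∃ S, IsMatching S ∧ e ∈ S ∧ weightWith e v + v e = ∑ f ∈ S, v f := by
  classical
  obtain ⟨S, hS, h⟩ := Finset.exists_mem_eq_sup'
    (s := Finset.univ.filter fun S : Finset G => IsMatching S ∧ e ∈ S)
    ⟨{e}, by simp [isMatching_singleton]⟩ fun S => ∑ f ∈ S.erase e, v f
  simp only [Finset.mem_filter, Finset.mem_univ, true_and] at hS
  refine ⟨S, hS.1, hS.2, ?_⟩
  rw [← Finset.sum_erase_add _ _ hS.2, ← h]
  rfl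

lemma exists_weightWithout (e : G) (v : Profile G) :
    ∃ S, IsMatching S ∧ e ∉ S ∧ weightWithout e v = ∑ f ∈ S, v f := by
  classical
  obtain ⟨S, hS, h⟩ := Finset.exists_mem_eq_sup'
    (s := Finset.univ.filter fun S : Finset G => IsMatching S ∧ e ∉ S)
    ⟨∅, by simp [isMatching_empty]⟩ fun S => ∑ f ∈ S, v f
  simp only [Finset.mem_filter, Finset.mem_univ, true_and] at hS
  exact ⟨S, hS.1, hS.2, h⟩

lemma exists_max_matching (v : Profile G) :
    ∃ S, IsMatching S ∧ ∀ S', IsMatching S' → ∑ f ∈ S', v f ≤ ∑ f ∈ S, v f := by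
  classical
  obtain ⟨S, hS, hmax⟩ := Finset.exists_max_image
    (Finset.univ.filter fun S : Finset G => IsMatching S) (fun S => ∑ f ∈ S, v f)
    ⟨∅, by simp [isMatching_empty]⟩
  exact ⟨S, by simpa using hS, fun S' hS' => hmax S' (by simp [hS'])⟩

/-- Neither maximum involves the value of `e`, and deleting `e` from a matching leaves a matching,
whence nonnegativity. An edge strictly above its threshold lies in every maximum weight matching,
which gives packing. -/
theorem isThreshold_matchingThreshold : IsThreshold (matchingThreshold (G := G)) where
  measurable e := by
    classical
    refine Measurable.sub ?_ ?_
    · have := Finset.measurable_sup' (s := Finset.univ.filter fun S : Finset G =>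
        IsMatching S ∧ e ∉ S) ⟨∅, by simp [isMatching_empty]⟩
        (f := fun S (v : Profile G) => ∑ f ∈ S, v f) fun S _ => by fun_prop
      convert this using 1
      funext v
      exact (Finset.sup'_apply _ _ _).symm
    · have := Finset.measurable_sup' (s := Finset.univ.filter fun S : Finset G =>
        IsMatching S ∧ e ∈ S) ⟨{e}, by simp [isMatching_singleton]⟩
        (f := fun S (v : Profile G) => ∑ f ∈ S.erase e, v f) fun S _ => by fun_prop
      convert this using 1
      funext v
      exact (Finset.sup'_apply _ _ _).symm
  nonneg e v := by
    classical
    refine sub_nonneg.2 (Finset.sup'_le _ _ fun S hS => ?_)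
    simp only [Finset.mem_filter, Finset.mem_univ, true_and] at hS
    exact sum_le_weightWithout (hS.1.subset (Finset.erase_subset e S)) (Finset.notMem_erase e S) v
  update e v x := by
    classical
    unfold matchingThreshold weightWithout weightWith
    congr 1
    · refine Finset.sup'_congr _ rfl fun S hS => Finset.sum_congr rfl fun f hf => ?_
      simp only [Finset.mem_filter, Finset.mem_univ, true_and] at hS
      exact Function.update_of_ne (fun h : f = e => hS.2 (h ▸ hf)) _ _
    · refine Finset.sup'_congr _ rfl fun S hS => Finset.sum_congr rfl fun f hf => ?_
      exact Function.update_of_ne (Finset.ne_of_mem_erase hf) _ _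
  packing v _ := by
    obtain ⟨S, hS, hmax⟩ := exists_max_matching v
    have key : ∀ e, matchingThreshold e v < v e → e ∈ S := by
      intro e he
      by_contra hn
      obtain ⟨S', hS', -, h'⟩ := exists_weightWith e v
      have h1 := sum_le_weightWithout hS hn v
      have h2 := hmax S' hS'
      unfold matchingThreshold at he
      linarith
    exact fun e e' hc he he' => hS.not_conflict (key e he) (key e' he') hc

lemma matchingThreshold_le {v : Profile G} {S : Finset G} (hS : IsMatching S)
    (hmax : ∀ S', IsMatching S' → ∑ f ∈ S', v f ≤ ∑ f ∈ S, v f) {e : G} (he : e ∈ S) :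
    matchingThreshold e v ≤ v e := by
  obtain ⟨S', hS', -, h'⟩ := exists_weightWithout e v
  have h1 := sum_erase_le_weightWith hS he v
  have h2 := hmax S' hS'
  rw [← Finset.sum_erase_add _ _ he] at h2
  unfold matchingThreshold
  linarith

open Classical in
/-- No matching is worth more than the edges with values above their thresholds. -/
lemma sum_le_sum_matchingThreshold {v : Profile G} (hv : ∀ f, 0 ≤ v f) {S : Finset G}
    (hS : IsMatching S) :
    ∑ f ∈ S, v f ≤ ∑ f : G, if matchingThreshold f v ≤ v f then v f else 0 := by
  obtain ⟨S', hS', hmax⟩ := exists_max_matching v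
  refine (hmax S hS).trans ?_
  rw [← Finset.sum_filter]
  refine Finset.sum_le_sum_of_subset_of_nonneg (fun f hf => ?_) fun f _ _ => hv f
  simp [matchingThreshold_le hS' hmax hf]

/-! ### Thresholds from greedy matchings -/

/-- `S` consists of the edges that are not dominated by a conflicting edge of `S`. -/
def IsStable (r : G → G → Prop) (S : Finset G) : Prop :=
  ∀ f, f ∈ S ↔ ∀ f', Conflict f f' → r f f' → f' ∉ S

lemma wellFounded_value (v : Profile G) : WellFounded fun f' f : G => v f < v f' := by
  have : IsTrans G fun f' f => v f < v f' := ⟨fun a b c h1 h2 => h2.trans h1⟩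
  have : Std.Irrefl fun f' f : G => v f < v f' := ⟨fun a h => lt_irrefl _ h⟩
  exact Finite.wellFounded_of_trans_of_irrefl _

/-- Recursion along decreasing values. Conflicting edges of equal value do not dominate each other,
so with ties a stable set need not be a matching; nothing below requires it to be one. -/
lemma exists_isStable (v : Profile G) : ∃ S, IsStable (fun f f' => v f < v f') S := by
  classical
  let F : ∀ f : G, (∀ f' : G, v f < v f' → Prop) → Prop := fun f ih =>
    ∀ f', Conflict f f' → ∀ h : v f < v f', ¬ ih f' h
  refine ⟨Finset.univ.filter fun f => (wellFounded_value v).fix F f, fun f => ?_⟩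
  simp only [Finset.mem_filter, Finset.mem_univ, true_and]
  rw [WellFounded.fix_eq]

open Classical in
/-- The stable set of a dominance relation, if there is one. -/
def stableSet (r : G → G → Prop) : Finset G := if h : ∃ S, IsStable r S then h.choose else ∅

/-- The edges that the greedy algorithm selects, in the order of decreasing values. -/
def greedySet (v : Profile G) : Finset G := stableSet fun f f' => v f < v f'

lemma mem_greedySet {v : Profile G} {f : G} :
    f ∈ greedySet v ↔ ∀ f', Conflict f f' → v f < v f' → f' ∉ greedySet v := by
  have h := exists_isStable v
  have hs : greedySet v = h.choose := by rw [greedySet, stableSet, dif_pos h]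
  rw [hs]
  exact h.choose_spec f

/-- The greedy set depends on v only through the relation `v f < v f'`, and there are finitely many
relations on the edges. -/
lemma measurableSet_mem_greedySet (f : G) : MeasurableSet {v : Profile G | f ∈ greedySet v} := by
  have hm : Measurable fun (v : Profile G) (f f' : G) => v f < v f' :=
    measurable_pi_iff.2 fun f => measurable_pi_iff.2 fun f' =>
      measurableSet_setOfPred.1 (measurableSet_lt (measurable_pi_apply f) (measurable_pi_apply f'))
  exact (Set.toFinite {r : G → G → Prop | f ∈ stableSet r}).measurableSet.preimage hm

/-- The value -1 lies below all others, so `e` dominates nothing and is effectively deleted.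
Selection of an edge worth at least `v e` depends only on strictly larger edges, which are
unaffected. -/
lemma mem_greedySet_update {v : Profile G} (hv : ∀ f, 0 ≤ v f) (e : G) (f : G) (hf : f ≠ e)
    (hef : v e ≤ v f) : f ∈ greedySet (Function.update v e (-1)) ↔ f ∈ greedySet v := by
  induction f using (wellFounded_value v).induction with
  | _ f ih =>
    rw [mem_greedySet, mem_greedySet (v := v)]
    refine forall_congr' fun f' => imp_congr_right fun _ => ?_
    rw [Function.update_of_ne hf]
    by_cases hf' : f' = e
    · subst hf'
      rw [Function.update_self]
      have := hv f
      exact iff_of_true (fun h => by linarith) fun h => absurd h (not_lt.2 hef)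
    · rw [Function.update_of_ne hf']
      exact imp_congr_right fun h => not_congr (ih f' h hf' (hef.trans h.le))

open Classical in
/-- The value from which on the greedy algorithm selects `e`. -/
def greedyThreshold (e : G) (v : Profile G) : ℝ :=
  Finset.univ.sup' ⟨e, Finset.mem_univ e⟩ fun f : G =>
    if Conflict e f ∧ f ∈ greedySet (Function.update v e (-1)) then v f else 0

lemma le_greedyThreshold {v : Profile G} {e f : G} (hc : Conflict e f)
    (hf : f ∈ greedySet (Function.update v e (-1))) : v f ≤ greedyThreshold e v := by
  classical
  have := Finset.le_sup' (fun f : G =>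
    if Conflict e f ∧ f ∈ greedySet (Function.update v e (-1)) then v f else 0) (Finset.mem_univ f)
  rwa [if_pos ⟨hc, hf⟩] at this

lemma isThreshold_greedyThreshold : IsThreshold (greedyThreshold (G := G)) where
  measurable e := by
    classical
    have := Finset.measurable_sup' (s := (Finset.univ : Finset G)) ⟨e, Finset.mem_univ e⟩
      (f := fun f (v : Profile G) =>
        if Conflict e f ∧ f ∈ greedySet (Function.update v e (-1)) then v f else 0) fun f _ => by
        refine Measurable.ite ?_ (measurable_pi_apply f) measurable_const
        refine (MeasurableSet.const _).inter ((measurableSet_mem_greedySet f).preimage ?_)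
        refine measurable_pi_iff.2 fun f => ?_
        by_cases hf : f = e
        · subst hf; simp
        · simp only [Function.update_of_ne hf]; fun_prop
    convert this using 1
    funext v
    exact (Finset.sup'_apply (C := fun _ : Profile G => ℝ) ⟨e, Finset.mem_univ e⟩
      (fun f (v : Profile G) =>
        if Conflict e f ∧ f ∈ greedySet (Function.update v e (-1)) then v f else 0) v).symm
  nonneg e v := by
    classical
    have := Finset.le_sup' (fun f : G =>
      if Conflict e f ∧ f ∈ greedySet (Function.update v e (-1)) then v f else 0)
      (Finset.mem_univ e)
    rwa [if_neg fun h => h.1.1 rfl] at this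
  update e v x := by
    classical
    unfold greedyThreshold
    refine Finset.sup'_congr _ rfl fun f _ => ?_
    rw [Function.update_idem]
    by_cases hf : f = e
    · subst hf
      rw [if_neg fun h => h.1.1 rfl, if_neg fun h => h.1.1 rfl]
    · rw [Function.update_of_ne hf]
  packing := by
    -- If the larger edge `e'` is strictly above its threshold, the greedy algorithm selects it,
    -- also after deleting `e`. It then raises the threshold of `e` to at least `v e'`, which is at
    -- least `v e`.
    have key : ∀ v : Profile G, (∀ f, 0 ≤ v f) → ∀ e e', Conflict e e' → v e ≤ v e' →
        greedyThreshold e v < v e → ¬ greedyThreshold e' v < v e' := by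
      intro v hv e e' hc hle he he'
      have hmem : e' ∈ greedySet v := by
        refine mem_greedySet.2 fun f hf hlt hfm => ?_
        have := le_greedyThreshold hf ((mem_greedySet_update hv e' f hf.1.symm hlt.le).2 hfm)
        linarith
      have := le_greedyThreshold hc ((mem_greedySet_update hv e e' hc.1.symm hle).2 hmem)
      linarith
    intro v hv e e' hc he he'
    rcases le_total (v e) (v e') with h | h
    · exact key v hv e e' hc h he he'
    · exact key v hv e' e hc.symm h he' he

lemma greedyThreshold_le {v : Profile G} (hv : ∀ f, 0 ≤ v f) {e : G} (he : e ∈ greedySet v) :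
    greedyThreshold e v ≤ v e := by
  classical
  refine Finset.sup'_le _ _ fun f _ => ?_
  split_ifs with h
  · by_contra! hlt
    exact mem_greedySet.1 he f h.1 hlt ((mem_greedySet_update hv e f h.1.1.symm hlt.le).1 h.2)
  · exact hv e

open Classical in
/-- For weights that are ordered like the values, no matching is worth more than twice the edges
with values above their greedy thresholds. -/
lemma sum_le_sum_greedyThreshold {v : Profile G} (hv : ∀ f, 0 ≤ v f) {w : G → ENNReal}
    (hw : ∀ f f', v f ≤ v f' → w f ≤ w f') {S : Finset G} (hS : IsMatching S) :
    ∑ f ∈ S, w f ≤ 2 * ∑ f : G, if greedyThreshold f v ≤ v f then w f else 0 := by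
  -- Each edge of S is charged to a greedy edge, itself or one that dominates it. As S is a
  -- matching, a greedy edge is charged at most once through its buyer and once through its item:
  -- the factor 2.
  have h1 : ∀ e ∈ S, w e ≤ ∑ g ∈ greedySet v, ((if g.1.1 = e.1.1 then w g else 0) +
      if g.1.2 = e.1.2 then w g else 0) := by
    intro e _
    obtain ⟨g, hg, hge, hwg⟩ : ∃ g ∈ greedySet v, (g.1.1 = e.1.1 ∨ g.1.2 = e.1.2) ∧
        w e ≤ w g := by
      by_cases he : e ∈ greedySet v
      · exact ⟨e, he, Or.inl rfl, le_rfl⟩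
      · rw [mem_greedySet] at he
        push Not at he
        obtain ⟨g, hc, hlt, hg⟩ := he
        exact ⟨g, hg, hc.2.imp Eq.symm Eq.symm, hw _ _ hlt.le⟩
    refine (hwg.trans ?_).trans (Finset.single_le_sum (f := fun g : G =>
      (if g.1.1 = e.1.1 then w g else 0) + if g.1.2 = e.1.2 then w g else 0)
      (fun _ _ => zero_le) hg)
    rcases hge with h | h
    · rw [if_pos h]; exact le_self_add
    · rw [if_pos h]; exact le_add_self
  have hone : ∀ (x : ENNReal) (p : G → Prop) [DecidablePred p], (∀ e ∈ S, ∀ e' ∈ S, p e → p e' → e = e') →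
      (∑ e ∈ S, if p e then x else 0) ≤ x := by
    intro x p _ hp
    rw [← Finset.sum_filter, Finset.sum_const]
    have : (S.filter p).card ≤ 1 := Finset.card_le_one.2 fun a ha b hb =>
      hp a (Finset.mem_filter.1 ha).1 b (Finset.mem_filter.1 hb).1 (Finset.mem_filter.1 ha).2
        (Finset.mem_filter.1 hb).2
    calc (S.filter p).card • x ≤ 1 • x := nsmul_le_nsmul_left zero_le this
      _ = x := one_nsmul x
  refine (Finset.sum_le_sum h1).trans ?_
  rw [Finset.sum_comm, Finset.mul_sum]
  calc ∑ g ∈ greedySet v, ∑ e ∈ S, ((if g.1.1 = e.1.1 then w g else 0) +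
        if g.1.2 = e.1.2 then w g else 0)
      ≤ ∑ g ∈ greedySet v, 2 * w g := by
        refine Finset.sum_le_sum fun g _ => ?_
        rw [Finset.sum_add_distrib, two_mul]
        refine add_le_add (hone _ _ fun e he e' he' h h' => ?_)
          (hone _ _ fun e he e' he' h h' => ?_)
        · by_contra hne
          exact (hS e he e' he' hne).1 (h.symm.trans h')
        · by_contra hne
          exact (hS e he e' he' hne).2 (h.symm.trans h')
    _ = ∑ g ∈ greedySet v, 2 * (if greedyThreshold g v ≤ v g then w g else 0) :=
        Finset.sum_congr rfl fun g hg => by rw [if_pos (greedyThreshold_le hv hg)]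
    _ ≤ _ := Finset.sum_le_sum_of_subset (Finset.subset_univ _)

end Thresholds

/-! ### Upper bounds on the revenue of mechanisms -/

section UpperBounds

variable {B I : Type*} [Fintype B] [DecidableEq B] [DecidableEq I] {G : Finset (B × I)}

open Classical in
/-- The surplus of the edges with values above their thresholds. -/
lemma lintegral_threshold (D : G → Measure ℝ) [∀ e, IsProbabilityMeasure (D e)]
    {T : G → Profile G → ℝ} (hT : IsThreshold T) (e : G) {w : ℝ → ENNReal} (hw : Measurable w) :
    ∫⁻ v, (if T e v ≤ v e then w (v e) else 0) ∂Measure.pi D =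
      ∫⁻ v, ∫⁻ x in Ici (T e v), w x ∂D e ∂Measure.pi D := by
  have hm : Measurable fun v : Profile G => if T e v ≤ v e then w (v e) else 0 :=
    Measurable.ite (measurableSet_le (hT.measurable e) (measurable_pi_apply e))
      (hw.comp (measurable_pi_apply e)) measurable_const
  rw [lintegral_pi_eq_update D e hm]
  refine lintegral_congr fun v => ?_
  rw [← lintegral_indicator measurableSet_Ici]
  refine lintegral_congr fun x => ?_
  rw [hT.update, Function.update_self, indicator_apply]
  rfl

namespace Mechanism

variable {M : Mechanism G}

lemma sum_allocProb_mul (v b : Profile G) :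
    ∑ e, M.allocProb b e * v e = ∑ S, M.lottery b S * ∑ e ∈ S, v e := by
  classical
  simp only [allocProb, Finset.sum_mul, Finset.sum_filter, Finset.mul_sum]
  rw [Finset.sum_comm]
  refine Finset.sum_congr rfl fun S _ => ?_
  simp only [ite_mul, zero_mul]
  rw [Finset.sum_ite_mem, Finset.univ_inter]

lemma sum_pay_le {v : Profile G} (hv : ∀ f, 0 ≤ v f) (hM : M.IndividuallyRational) :
    ∑ i, M.pay v i ≤ ∑ S, M.lottery v S * ∑ e ∈ S, v e := by
  rw [← sum_allocProb_mul,
    ← Finset.sum_fiberwise Finset.univ (fun e : G => e.1.1) fun e => M.allocProb v e * v e]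
  exact Finset.sum_le_sum fun i _ => sub_nonneg.1 (hM i v hv)

/-- The revenue is at most the expected weight of a maximum weight matching. -/
theorem lintegral_pay_le_matching (hM : M.IndividuallyRational) (D : G → Measure ℝ)
    [∀ e, IsProbabilityMeasure (D e)] (hD : ∀ e, D e (Iio 0) = 0) :
    ∫⁻ v, ENNReal.ofReal (∑ i, M.pay v i) ∂Measure.pi D ≤
      ∑ e, ∫⁻ v, ∫⁻ x in Ici (matchingThreshold e v), ENNReal.ofReal x ∂D e ∂Measure.pi D := by
  classical
  have hT := isThreshold_matchingThreshold (G := G)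
  simp only [← lintegral_threshold D hT _ ENNReal.measurable_ofReal]
  rw [← lintegral_finsetSum _ fun e _ => Measurable.ite (measurableSet_le (hT.measurable e)
    (measurable_pi_apply e)) (measurable_pi_apply e).ennreal_ofReal measurable_const]
  refine lintegral_mono_ae ?_
  filter_upwards [ae_pi_nonneg D hD] with v hv
  have h1 : ∑ i, M.pay v i ≤ ∑ f : G, if matchingThreshold f v ≤ v f then v f else 0 := by
    refine (sum_pay_le hv hM).trans ?_
    have h2 : ∀ S, M.lottery v S * ∑ e ∈ S, v e ≤
        M.lottery v S * ∑ f : G, if matchingThreshold f v ≤ v f then v f else 0 := by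
      intro S
      by_cases hS : M.lottery v S = 0
      · rw [hS, zero_mul, zero_mul]
      · exact mul_le_mul_of_nonneg_left
          (sum_le_sum_matchingThreshold hv (M.lottery_feasible v S hS)) (M.lottery_nonneg v S)
    refine (Finset.sum_le_sum fun S _ => h2 S).trans (le_of_eq ?_)
    rw [← Finset.sum_mul, M.lottery_sum, one_mul]
  refine (ENNReal.ofReal_le_ofReal h1).trans (le_of_eq ?_)
  rw [ENNReal.ofReal_sum_of_nonneg fun f _ => by split_ifs; exacts [hv f, le_rfl]]
  refine Finset.sum_congr rfl fun f _ => ?_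
  split_ifs <;> simp

lemma measurable_allocProb (M : Mechanism G) (e : G) : Measurable fun b => M.allocProb b e :=
  Finset.measurable_sum _ fun S _ => M.measurable_lottery S

open Classical in
lemma Deterministic.exists_allocation (hM : M.Deterministic) (b : Profile G) :
    ∃ S, IsMatching S ∧ ∀ e, M.allocProb b e = if e ∈ S then 1 else 0 := by
  obtain ⟨S, hS⟩ := hM b
  refine ⟨S, M.lottery_feasible b S (by rw [hS]; exact one_ne_zero), fun e => ?_⟩
  have h0 : ∀ S', S' ≠ S → M.lottery b S' = 0 := by
    have h := M.lottery_sum b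
    rw [← Finset.add_sum_erase _ _ (Finset.mem_univ S), hS, add_eq_left,
      Finset.sum_eq_zero_iff_of_nonneg fun S' _ => M.lottery_nonneg b S'] at h
    exact fun S' hS' => h S' (Finset.mem_erase.2 ⟨hS', Finset.mem_univ _⟩)
  rw [allocProb, Finset.sum_filter]
  rw [Finset.sum_eq_single S (fun S' _ hS' => by rw [h0 S' hS', ite_self])
    fun h => absurd (Finset.mem_univ S) h, hS]

lemma Deterministic.utility_eq (hM : M.Deterministic) (v : Profile G) {b : Profile G} {e : G}
    (he : M.allocProb b e = 1) : M.utility e.1.1 v b = v e - M.pay b e.1.1 := by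
  classical
  obtain ⟨S, hS, hSe⟩ := hM.exists_allocation b
  have heS : e ∈ S := by
    by_contra h
    rw [hSe, if_neg h] at he
    exact zero_ne_one he
  rw [utility, Finset.sum_eq_single_of_mem e (by simp) fun f hf hne => ?_, he, one_mul]
  rw [hSe, if_neg fun hfS => (hS f hfS e heS hne).1 (Finset.mem_filter.1 hf).2, zero_mul]

lemma Deterministic.allocProb_eq (hM : M.Deterministic) (b : Profile G) (e : G) :
    M.allocProb b e = 0 ∨ M.allocProb b e = 1 := by
  classical
  obtain ⟨S, -, hSe⟩ := hM.exists_allocation b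
  rw [hSe]
  split_ifs <;> simp

/-- Pay no more than the value. -/
lemma Deterministic.pay_le (hM : M.Deterministic) (hI : M.IndividuallyRational) {v : Profile G}
    (hv : ∀ f, 0 ≤ v f) {e : G} (he : M.allocProb v e = 1) : M.pay v e.1.1 ≤ v e := by
  have := hI e.1.1 v hv
  rw [hM.utility_eq v he] at this
  linarith

lemma update_nonneg {v : Profile G} (hv : ∀ f, 0 ≤ v f) (e : G) {x : ℝ} (hx : 0 ≤ x) (f : G) :
    0 ≤ Function.update v e x f := by
  by_cases hf : f = e
  · subst hf; rwa [Function.update_self]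
  · rw [Function.update_of_ne hf]; exact hv f

/-- The price of an edge does not depend on its value. -/
lemma Deterministic.pay_update_le (hM : M.Deterministic) (hT : M.Truthful) {v : Profile G}
    (hv : ∀ f, 0 ≤ v f) {e : G} {x y : ℝ} (hx : 0 ≤ x) (hy : 0 ≤ y)
    (hex : M.allocProb (Function.update v e x) e = 1)
    (hey : M.allocProb (Function.update v e y) e = 1) :
    M.pay (Function.update v e x) e.1.1 ≤ M.pay (Function.update v e y) e.1.1 := by
  have h := hT e.1.1 (Function.update v e x) (Function.update v e y) (update_nonneg hv e hx)
    (update_nonneg hv e hy) fun f hf => by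
      have hfe : f ≠ e := fun h => hf (h ▸ rfl)
      rw [Function.update_of_ne hfe, Function.update_of_ne hfe]
  rw [hM.utility_eq _ hex, hM.utility_eq _ hey] at h
  linarith

/-- Raising the value of an edge that is sold does not change that it is sold. -/
lemma Deterministic.allocProb_update (hM : M.Deterministic) (hT : M.Truthful) {v : Profile G}
    (hv : ∀ f, 0 ≤ v f) {e : G} {x y : ℝ} (hx : 0 ≤ x) (hxy : x ≤ y)
    (hex : M.allocProb (Function.update v e x) e = 1) :
    M.allocProb (Function.update v e y) e = 1 := by
  rcases hxy.eq_or_lt with rfl | hlt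
  · exact hex
  refine (hM.allocProb_eq _ e).resolve_left fun h0 => ?_
  have hne : ∀ f : G, f.1.1 ≠ e.1.1 → f ≠ e := fun f hf h => hf (h ▸ rfl)
  have hvx := update_nonneg hv e hx
  have hvy := update_nonneg hv e (hx.trans hxy)
  have h1 := hT e.1.1 _ _ hvx hvy fun f hf => by
    rw [Function.update_of_ne (hne f hf), Function.update_of_ne (hne f hf)]
  have h2 := hT e.1.1 _ _ hvy hvx fun f hf => by
    rw [Function.update_of_ne (hne f hf), Function.update_of_ne (hne f hf)]
  -- If y does not win `e`, the utility of reporting y ignores the value of `e`. Truthfulness at x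
  -- and at y then sandwiches it between y and x minus the same payment, impossible for x < y.
  have h3 : M.utility e.1.1 (Function.update v e x) (Function.update v e y) =
      M.utility e.1.1 (Function.update v e y) (Function.update v e y) := by
    unfold utility
    congr 1
    refine Finset.sum_congr rfl fun f _ => ?_
    by_cases hf : f = e
    · subst hf; rw [h0, zero_mul, zero_mul]
    · rw [Function.update_of_ne hf, Function.update_of_ne hf]
  rw [h3, hM.utility_eq _ hex, Function.update_self] at h1
  rw [hM.utility_eq _ hex, Function.update_self] at h2
  linarith

-- Individual rationality gives a buyer who receives nothing a nonpositive payment, so positive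
-- payments can be attributed to sold edges.
open Classical in
lemma Deterministic.ofReal_sum_pay_le (hM : M.Deterministic) (hI : M.IndividuallyRational)
    {v : Profile G} (hv : ∀ f, 0 ≤ v f) :
    ENNReal.ofReal (∑ i, M.pay v i) ≤
      ∑ e : G, if M.allocProb v e = 1 then ENNReal.ofReal (M.pay v e.1.1) else 0 := by
  rw [← Finset.sum_fiberwise Finset.univ (fun e : G => e.1.1)]
  have h1 : ENNReal.ofReal (∑ i, M.pay v i) ≤ ∑ i, ENNReal.ofReal (M.pay v i) := by
    refine Finset.le_sum_of_subadditive _ ENNReal.ofReal_zero.le (fun _ _ => ENNReal.ofReal_add_le)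
      _ _
  refine h1.trans (Finset.sum_le_sum fun i _ => ?_)
  by_cases hex : ∃ e : G, e.1.1 = i ∧ M.allocProb v e = 1
  · obtain ⟨e, rfl, he⟩ := hex
    have := Finset.single_le_sum
      (f := fun f : G => if M.allocProb v f = 1 then ENNReal.ofReal (M.pay v f.1.1) else 0)
      (s := Finset.univ.filter fun f : G => f.1.1 = e.1.1) (fun _ _ => zero_le)
      (Finset.mem_filter.2 ⟨Finset.mem_univ e, rfl⟩)
    simpa only [if_pos he] using this
  · have hu := hI i v hv
    rw [utility, Finset.sum_eq_zero fun f hf => ?_] at hu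
    · rw [ENNReal.ofReal_eq_zero.2 (by linarith)]
      exact zero_le
    · rw [(hM.allocProb_eq v f).resolve_right fun h => hex ⟨f, (Finset.mem_filter.1 hf).2, h⟩,
        zero_mul]

end Mechanism

/-! ### Virtual surplus bound for deterministic mechanisms, and transfer to revenue ratios -/

variable {μ : Measure ℝ} [IsProbabilityMeasure μ] {f : ℝ → ℝ}

/-- The revenue from a price that is at most every value in an upper set of accepted values. -/
lemma ofReal_mul_measure_le (h : HasValueDensity μ f) {A : Set ℝ} (hA : A ⊆ Ici 0)
    (hup : ∀ x ∈ A, ∀ y, x ≤ y → y ∈ A) {p : ℝ} (hp : ∀ x ∈ A, p ≤ x) :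
    ENNReal.ofReal p * μ A ≤
      revenueAtInfinity μ + ∫⁻ x in A, ENNReal.ofReal (virtualValue μ f x) ∂μ := by
  have hns := h.nullSingletonClass
  rcases A.eq_empty_or_nonempty with rfl | hne
  · simp
  have hbdd : BddBelow A := ⟨0, fun x hx => hA hx⟩
  have hτ : 0 ≤ sInf A := le_csInf hne fun x hx => hA hx
  have hpτ : p ≤ sInf A := le_csInf hne hp
  calc ENNReal.ofReal p * μ A ≤ ENNReal.ofReal (sInf A) * μ (Ici (sInf A)) :=
        mul_le_mul' (ENNReal.ofReal_le_ofReal hpτ) (measure_mono fun x hx => csInf_le hbdd hx)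
    _ = ENNReal.ofReal (sInf A * survival μ (sInf A)) := by
        rw [ENNReal.ofReal_mul hτ, ofReal_survival]
    _ ≤ revenueAtInfinity μ + ∫⁻ x in Ici (sInf A), ENNReal.ofReal (virtualValue μ f x) ∂μ :=
        revenue_le_revenueAtInfinity_add h _
    _ ≤ _ := by
        rw [setLIntegral_congr Ioi_ae_eq_Ici.symm]
        refine add_le_add le_rfl (lintegral_mono_set fun x hx => ?_)
        obtain ⟨a, ha, hax⟩ := exists_lt_of_csInf_lt hne hx
        exact hup a ha x hax.le

/-- The revenue of a deterministic mechanism is at most the virtual surplus of a matching and the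
revenues at infinity of all edges. -/
theorem Mechanism.lintegral_pay_le_greedy {M : Mechanism G} (hT : M.Truthful)
    (hI : M.IndividuallyRational) (hM : M.Deterministic) (h : HasValueDensity μ f)
    (hmono : MonotoneOn (virtualValue μ f) {x | 0 < cdf μ x ∧ cdf μ x < 1}) :
    ∫⁻ v, ENNReal.ofReal (∑ i, M.pay v i) ∂Measure.pi (fun _ : G => μ) ≤
      2 * ∑ e : G, ∫⁻ v, (revenueAtInfinity μ + ∫⁻ x in Ici (greedyThreshold e v),
        ENNReal.ofReal (virtualValue μ f x) ∂μ) ∂Measure.pi (fun _ : G => μ) := by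
  classical
  set Q := Measure.pi (fun _ : G => μ) with hQ
  set w : ℝ → ENNReal := fun x => ENNReal.ofReal (virtualValue μ f x) with hw
  have hwm : Measurable w := h.measurable_virtualValue.ennreal_ofReal
  have hae := ae_pi_nonneg (fun _ : G => μ) fun _ => h.support
  have hae0 : ∀ᵐ v ∂Q, ∀ e : G, 0 < cdf μ (v e) := ae_all_iff.2 fun e =>
    (Measure.quasiMeasurePreserving_eval (fun _ : G => μ) e).ae h.ae_cdf_pos
  have hwon : ∀ e : G, MeasurableSet {v | M.allocProb v e = 1} := fun e =>
    M.measurable_allocProb e (measurableSet_singleton 1)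
  have hgm : ∀ e : G, Measurable fun v : Profile G =>
      if M.allocProb v e = 1 then ENNReal.ofReal (M.pay v e.1.1) else 0 := fun e =>
    Measurable.ite (hwon e) (M.measurable_pay e.1.1).ennreal_ofReal measurable_const
  have hwe : ∀ e : G, Measurable fun v : Profile G =>
      if M.allocProb v e = 1 then w (v e) else 0 := fun e =>
    Measurable.ite (hwon e) (hwm.comp (measurable_pi_apply e)) measurable_const
  have hone : ∀ e : G, ∫⁻ v, (if M.allocProb v e = 1 then ENNReal.ofReal (M.pay v e.1.1) else 0) ∂Q
      ≤ revenueAtInfinity μ + ∫⁻ v, (if M.allocProb v e = 1 then w (v e) else 0) ∂Q := by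
    intro e
    rw [lintegral_pi_eq_update _ e (hgm e), lintegral_pi_eq_update _ e (hwe e)]
    refine le_trans (lintegral_mono_ae (g := fun v => revenueAtInfinity μ + ∫⁻ x,
      (if M.allocProb (Function.update v e x) e = 1 then w (Function.update v e x e) else 0) ∂μ)
      ?_) ?_
    swap
    · rw [lintegral_add_left measurable_const, lintegral_const, measure_univ, mul_one]
    filter_upwards [hae] with v hv
    -- With all other values fixed, the winning values of `e` form an upper set on which the payment
    -- is constant and at most every winning value: a posted price.
    set A := {x | 0 ≤ x ∧ M.allocProb (Function.update v e x) e = 1} with hA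
    have hup : ∀ x ∈ A, ∀ y, x ≤ y → y ∈ A := fun x hx y hxy =>
      ⟨hx.1.trans hxy, hM.allocProb_update hT hv hx.1 hxy hx.2⟩
    have hAm : MeasurableSet A := (show IsUpperSet A from fun x y hxy hx => hup x hx y hxy)
      |>.ordConnected.measurableSet
    have hx0 : ∀ᵐ x ∂μ, 0 ≤ x := h.ae_pos.mono fun x hx => hx.le
    obtain ⟨p, hp, hpA⟩ : ∃ p, (∀ x ∈ A, p ≤ x) ∧
        ∀ x ∈ A, M.pay (Function.update v e x) e.1.1 ≤ p := by
      rcases A.eq_empty_or_nonempty with hE | ⟨x₀, hx₀⟩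
      · exact ⟨0, by simp [hE], by simp [hE]⟩
      · refine ⟨M.pay (Function.update v e x₀) e.1.1, fun x hx => ?_, fun x hx =>
          hM.pay_update_le hT hv hx.1 hx₀.1 hx.2 hx₀.2⟩
        refine (hM.pay_update_le hT hv hx₀.1 hx.1 hx₀.2 hx.2).trans ?_
        have := hM.pay_le hI (Mechanism.update_nonneg hv e hx.1) hx.2
        rwa [Function.update_self] at this
    have hL : ∫⁻ x, (if M.allocProb (Function.update v e x) e = 1 then
        ENNReal.ofReal (M.pay (Function.update v e x) e.1.1) else 0) ∂μ ≤
        ENNReal.ofReal p * μ A := by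
      rw [← setLIntegral_const, ← lintegral_indicator hAm]
      refine lintegral_mono_ae ?_
      filter_upwards [hx0] with x hx
      by_cases hw1 : M.allocProb (Function.update v e x) e = 1
      · have hxA : x ∈ A := ⟨hx, hw1⟩
        rw [if_pos hw1, indicator_of_mem hxA]
        exact ENNReal.ofReal_le_ofReal (hpA x hxA)
      · rw [if_neg hw1]; exact zero_le
    refine (hL.trans (ofReal_mul_measure_le h (fun x hx => hx.1) hup hp)).trans
      (add_le_add le_rfl ?_)
    rw [← lintegral_indicator hAm]
    refine lintegral_mono fun x => ?_
    by_cases hxA : x ∈ A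
    · rw [indicator_of_mem hxA, if_pos hxA.2, Function.update_self]
    · rw [indicator_of_notMem hxA]; exact zero_le
  have hTm : ∀ e : G, Measurable fun v : Profile G =>
      if greedyThreshold e v ≤ v e then w (v e) else 0 := fun e =>
    Measurable.ite (measurableSet_le (isThreshold_greedyThreshold.measurable e)
      (measurable_pi_apply e)) (hwm.comp (measurable_pi_apply e)) measurable_const
  calc ∫⁻ v, ENNReal.ofReal (∑ i, M.pay v i) ∂Q
      ≤ ∫⁻ v, ∑ e : G, (if M.allocProb v e = 1 then ENNReal.ofReal (M.pay v e.1.1) else 0) ∂Q := by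
        refine lintegral_mono_ae ?_
        filter_upwards [hae] with v hv using hM.ofReal_sum_pay_le hI hv
    _ = ∑ e : G, ∫⁻ v, (if M.allocProb v e = 1 then ENNReal.ofReal (M.pay v e.1.1) else 0) ∂Q :=
        lintegral_finsetSum _ fun e _ => hgm e
    _ ≤ ∑ e : G, (revenueAtInfinity μ +
          ∫⁻ v, (if M.allocProb v e = 1 then w (v e) else 0) ∂Q) :=
        Finset.sum_le_sum fun e _ => hone e
    _ = ∑ e : G, revenueAtInfinity μ +
          ∫⁻ v, ∑ e : G, (if M.allocProb v e = 1 then w (v e) else 0) ∂Q := by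
        rw [Finset.sum_add_distrib, lintegral_finsetSum _ fun e _ => hwe e]
    _ ≤ 2 * ∑ e : G, revenueAtInfinity μ +
          ∫⁻ v, 2 * ∑ e : G, (if greedyThreshold e v ≤ v e then w (v e) else 0) ∂Q := by
        -- The revenue at infinity is doubled only so that it can be paired, edge by edge, with the
        -- doubled greedy surplus.
        refine add_le_add ?_ (lintegral_mono_ae ?_)
        · rw [two_mul]; exact le_self_add
        · filter_upwards [hae, hae0] with v hv hv0
          obtain ⟨S, hS, hSe⟩ := hM.exists_allocation v
          have : ∑ e : G, (if M.allocProb v e = 1 then w (v e) else 0) = ∑ e ∈ S, w (v e) := by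
            rw [← Finset.sum_filter]
            refine Finset.sum_congr ?_ fun _ _ => rfl
            ext e
            simp [hSe]
          rw [this]
          exact sum_le_sum_greedyThreshold hv (fun a b hab =>
            ofReal_virtualValue_le h hmono (hv0 a) hab) hS
    _ = _ := by
        rw [lintegral_const_mul _ (Finset.measurable_sum _ fun e _ => hTm e),
          lintegral_finsetSum _ fun e _ => hTm e, ← mul_add, ← Finset.sum_add_distrib]
        congr 1
        refine Finset.sum_congr rfl fun e _ => ?_
        rw [lintegral_add_left measurable_const, lintegral_const, measure_univ, mul_one,
          lintegral_threshold _ isThreshold_greedyThreshold e hwm]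

/-- From an upper bound on the positive part of the revenue of a mechanism to its revenue. -/
lemma mul_revenue_le {M : Mechanism G} {N : ℕ} {T : G → Profile G → ℝ} (hT : IsThreshold T)
    {c : G → Fin N} {l : Fin N} (hcl : ∀ e, c e ≠ l) (hc : ∀ e e', Conflict e e' → c e ≠ c e')
    (D : G → Measure ℝ) [∀ e, IsProbabilityMeasure (D e)] [∀ e, NullSingletonClass (D e)]
    (hD : ∀ e, D e (Iio 0) = 0) {K r : ℝ} (hr : 0 ≤ r) (hrK : r * K ≤ 1 / 6)
    (hM : ∫⁻ v, ENNReal.ofReal (∑ i, M.pay v i) ∂Measure.pi D ≤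
      ENNReal.ofReal K * ∑ e, ∫⁻ v, sampleRevenue (D e) (T e v) ∂Measure.pi D) :
    (r : EReal) * M.revenue D ≤ (thresholdAuction hT c l).revenue D := by
  have hA : (thresholdAuction hT c l).revenue D =
      ((∫⁻ p, ENNReal.ofReal (∑ i, ((thresholdAuction hT c l).mech p.1).pay p.2 i)
        ∂sampleLaw D N : ENNReal) : EReal) := by
    classical
    refine expectation_of_nonneg _ fun p => ?_
    rw [show (thresholdAuction hT c l).mech p.1 = postedPrices (samplePrices T c l p.1) from rfl,
      sum_pay_eq]
    refine mul_nonneg (by positivity) (Finset.sum_nonneg fun θ _ => Finset.sum_nonneg fun e _ => ?_)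
    split_ifs
    exacts [hT.samplePrices_nonneg c l p.1 e, le_rfl]
  have hrr : (r : EReal) = ((ENNReal.ofReal r : ENNReal) : EReal) := by
    rw [EReal.coe_ennreal_ofReal, max_eq_left hr]
  calc (r : EReal) * M.revenue D
      ≤ r * ((∫⁻ v, ENNReal.ofReal (∑ i, M.pay v i) ∂Measure.pi D : ENNReal) : EReal) :=
        mul_le_mul_of_nonneg_left (expectation_le _ _) (EReal.coe_nonneg.2 hr)
    _ = ((ENNReal.ofReal r * ∫⁻ v, ENNReal.ofReal (∑ i, M.pay v i) ∂Measure.pi D : ENNReal) :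
          EReal) := by rw [hrr, EReal.coe_ennreal_mul]
    _ ≤ _ := by
        rw [hA, EReal.coe_ennreal_le_coe_ennreal_iff]
        refine le_trans ?_ (lintegral_pay_ge D hD hT hcl hc)
        refine (mul_le_mul_right hM _).trans ?_
        rw [← mul_assoc, ← ENNReal.ofReal_mul hr]
        exact mul_le_mul_left (ENNReal.ofReal_le_ofReal hrK) _

end UpperBounds

end UnitDemandMatching

end

/-! ### The two auctions and their constants -/

open UnitDemandMatching in
theorem mainTheorem8 (d : ℕ) {B I : Type*} [Fintype B] [Fintype I] [DecidableEq B] [DecidableEq I]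
    (G : Finset (B × I)) (hG : DegreeAtMost G d) :
    (∃ A : SampleAuction G (d ^ 2 + 1),
      (∀ s, (A.mech s).Truthful ∧ (A.mech s).IndividuallyRational) ∧
      ∀ (D : G → Measure ℝ) [∀ e, IsProbabilityMeasure (D e)], (∀ e, IsMHR (D e)) →
        ∀ M : Mechanism G, M.Truthful → M.IndividuallyRational →
          ((1 / (13.5 * Real.exp 1) : ℝ) : EReal) * M.revenue D ≤ A.revenue D) ∧
    (∃ A : SampleAuction G (d ^ 2 + 1),
      (∀ s, (A.mech s).Truthful ∧ (A.mech s).IndividuallyRational) ∧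
      ∀ (μ : Measure ℝ) [IsProbabilityMeasure μ], IsRegular μ →
        ∀ M : Mechanism G, M.Truthful → M.IndividuallyRational → M.Deterministic →
          ((1 / 27 : ℝ) : EReal) * M.revenue (fun _ => μ) ≤ A.revenue (fun _ => μ)) := by
  obtain ⟨c, hcl, hc⟩ := hG.exists_coloring
  refine ⟨⟨thresholdAuction isThreshold_matchingThreshold c (Fin.last _), fun s =>
    ⟨postedPrices_truthful _, postedPrices_individuallyRational _⟩, ?_⟩,
    ⟨thresholdAuction isThreshold_greedyThreshold c (Fin.last _), fun s =>
    ⟨postedPrices_truthful _, postedPrices_individuallyRational _⟩, ?_⟩⟩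
  · intro D _ hD M _ hI
    have hns : ∀ e, NullSingletonClass (D e) := fun e => by
      obtain ⟨f, h, -⟩ := hD e
      exact h.nullSingletonClass
    have h0 : ∀ e, D e (Set.Iio 0) = 0 := fun e => by
      obtain ⟨f, h, -⟩ := hD e
      exact h.support
    have he := Real.exp_pos 1
    -- K combines the factor e from welfare to price revenue with the factor 2 for the sampled
    -- reserve; 2e/(13.5e) = 4/27 ≤ 1/6.
    refine mul_revenue_le isThreshold_matchingThreshold hcl hc D h0
      (K := Real.exp 1 * 2) (by positivity) ?_ ?_
    · rw [div_mul_eq_mul_div, div_le_div_iff₀ (by positivity) (by norm_num)]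
      linarith
    · refine (Mechanism.lintegral_pay_le_matching hI D h0).trans ?_
      rw [Finset.mul_sum]
      refine Finset.sum_le_sum fun e _ => ?_
      rw [← MeasureTheory.lintegral_const_mul' _ _ ENNReal.ofReal_ne_top]
      refine lintegral_mono fun v => ?_
      have hT := isThreshold_matchingThreshold.nonneg e v
      refine ((hD e).lintegral_le hT fun p hp =>
        (hD e).isRegular.revenue_le_sampleRevenue hT hp).trans (le_of_eq ?_)
      rw [ENNReal.ofReal_mul he.le, mul_assoc, ENNReal.ofReal_ofNat]
  · intro μ _ hμ M hT hI hM
    obtain ⟨f, h, hpos, hmono⟩ := id hμ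
    have hns : NullSingletonClass μ := h.nullSingletonClass
    -- Here one factor 2 comes from the greedy matching and one from the reserve, again with 4/27 ≤
    -- 1/6.
    refine mul_revenue_le isThreshold_greedyThreshold hcl hc (fun _ => μ) (fun _ => h.support)
      (K := 2 * 2) (by norm_num) (by norm_num) ?_
    refine (Mechanism.lintegral_pay_le_greedy hT hI hM h hmono).trans ?_
    rw [ENNReal.ofReal_mul (by norm_num), ENNReal.ofReal_ofNat, mul_assoc]
    refine mul_le_mul_right ?_ _
    rw [Finset.mul_sum]
    refine Finset.sum_le_sum fun e _ => ?_
    rw [← MeasureTheory.lintegral_const_mul' _ _ (by simp)]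
    refine lintegral_mono fun v => ?_
    have hTn := isThreshold_greedyThreshold.nonneg e v
    exact revenueAtInfinity_add_le h hpos hmono hTn fun p hp =>
      hμ.revenue_le_sampleRevenue hTn hp
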